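/- For $n\ge 2$ let $\mathcal O_n$ be the Cuntz algebra, i.e. the universal unital C$^*$-algebra generated by $s^{(n)}_1,\dots,s^{(n)}_n$ with $s_i^{(n)*}s^{(n)}_j=\delta_{ij}I$ and $\sum_{i=1}^n s^{(n)}_is_i^{(n)*}=I$; let $\mathcal O_1=\mathbf C$ with $s^{(1)}_1=1$. For $n,m\ge 1$ let $\varphi_{n,m}:\mathcal O_{nm}\to\mathcal O_n\otimes\mathcal O_m$ (minimal C$^*$-tensor product) be the unital $*$-homomorphism with $\varphi_{n,m}(s^{(nm)}_{m(i-1)+j})=s^{(n)}_i\otimes s^{(m)}_j$ for $1\le i\le n$, $1\le j\le m$. For states $\omega$ of $\mathcal O_n$ and $\omega'$ of $\mathcal O_m$ put $\omega\otimes_\varphi\omega'=(\omega\otimes\omega')\circ\varphi_{n,m}$, where $(\omega\otimes\omega')(a\otimes b)=\omega(a)\omega'(b)$; for unital $*$-representations $\pi_1$ of $\mathcal O_n$ and $\pi_2$ of $\mathcal O_m$ put $\pi_1\otimes_\varphi\pi_2=(\pi_1\otimes\pi_2)\circ\varphi_{n,m}$, and for unitary equivalence classes put $[\pi_1]\otimes_\varphi[\pi_2]=[\pi_1\otimes_\varphi\pi_2]$.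 For a unit vector $z\in\mathbf C^n$, where for $n=1$ only $z=1$ is admitted, let $\varrho_z$ be the state of $\mathcal O_n$ with $$\varrho_z(s_{j_1}\cdots s_{j_a}s_{k_b}^*\cdots s_{k_1}^*)=\overline{z}_{j_1}\cdots\overline{z}_{j_a}z_{k_b}\cdots z_{k_1}$$ for all indices and all $a,b\ge 0$ (empty products are $I$ and $1$), and let $GP(z)$ be the unitary equivalence class of the GNS representation of $\varrho_z$. **Theorem.** Let $n,m\ge 1$, and let $z\in\mathbf C^n$ and $y\in\mathbf C^m$ be unit vectors, with $z=1$ if $n=1$ and $y=1$ if $m=1$. Define the unit vector $z\boxtimes y\in\mathbf C^{nm}$ by $(z\boxtimes y)_{m(i-1)+j}=z_iy_j$ for $1\le i\le n$, $1\le j\le m$. Then (i) $\varrho_z\otimes_\varphi\varrho_y=\varrho_{z\boxtimes y}$; (ii) $GP(z)\otimes_\varphi GP(y)=GP(z\boxtimes y)$. -/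

import Mathlib

noncomputable section

namespace CuntzGP

open scoped TensorProduct InnerProductSpace ComplexOrder
open UniformSpace

/-! ### C⋆-seminorms on unital complex ⋆-algebras and the associated C⋆-completions -/

section Seminorms

variable {R : Type*} [Ring R] [StarRing R] [Algebra ℂ R] [StarModule ℂ R]

/-- A C⋆-seminorm on a unital complex ⋆-algebra: a submultiplicative seminorm satisfying the
C⋆-identity `p (x⋆ x) = p x ^ 2`. -/
structure CStarSeminorm (R : Type*) [Ring R] [StarRing R] [Algebra ℂ R] [StarModule ℂ R] where
  /-- The underlying seminorm. -/
  toSeminorm : Seminorm ℂ R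
  mul_le' : ∀ x y, toSeminorm (x * y) ≤ toSeminorm x * toSeminorm y
  star_mul_self' : ∀ x, toSeminorm (star x * x) = toSeminorm x * toSeminorm x

namespace CStarSeminorm

instance : CoeFun (CStarSeminorm R) (fun _ => R → ℝ) := ⟨fun p => p.toSeminorm⟩

theorem nonneg (p : CStarSeminorm R) (x : R) : 0 ≤ p x := apply_nonneg p.toSeminorm x

theorem star_eq (p : CStarSeminorm R) (x : R) : p (star x) = p x := by
  have key : ∀ y : R, p y ≤ p (star y) := by
    intro y
    have h := p.mul_le' (star y) y
    rw [p.star_mul_self'] at h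
    rcases (p.nonneg y).eq_or_lt with h0 | h0
    · rw [← h0]; exact p.nonneg _
    · exact le_of_mul_le_mul_right h h0
  refine le_antisymm ?_ (key x)
  simpa using key (star x)

theorem one_le (p : CStarSeminorm R) : p 1 ≤ 1 := by
  have h := p.star_mul_self' 1
  simp only [star_one, mul_one] at h
  nlinarith [p.nonneg 1]

/-- The C⋆-seminorm `x ↦ ‖f x‖` given by a ⋆-homomorphism into a C⋆-algebra. -/
def ofHom {B : Type*} [CStarAlgebra B] (f : R →⋆ₐ[ℂ] B) : CStarSeminorm R where
  toSeminorm := (normSeminorm ℂ B).comp (f : R →ₐ[ℂ] B).toLinearMap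
  mul_le' x y := by simpa using norm_mul_le (f x) (f y)
  star_mul_self' x := by
    simpa [map_star] using CStarRing.norm_star_mul_self (x := f x)

@[simp]
theorem ofHom_apply {B : Type*} [CStarAlgebra B] (f : R →⋆ₐ[ℂ] B) (x : R) :
    ofHom f x = ‖f x‖ := rfl

/-- The pointwise supremum of a pointwise bounded set of C⋆-seminorms (zero for the empty set). -/
def sup (S : Set (CStarSeminorm R)) (hS : ∀ x, BddAbove (Set.range fun p : S => p.1 x)) :
    CStarSeminorm R where
  toSeminorm := Seminorm.of (fun x => ⨆ p : S, p.1 x)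
    (fun x y => Real.iSup_le
      (fun p => (map_add_le_add p.1.toSeminorm x y).trans
        (add_le_add (le_ciSup (hS x) p) (le_ciSup (hS y) p)))
      (add_nonneg (Real.iSup_nonneg fun p => p.1.nonneg x)
        (Real.iSup_nonneg fun p => p.1.nonneg y)))
    (fun a x => by
      rw [Real.mul_iSup_of_nonneg (norm_nonneg a)]
      exact iSup_congr fun p => map_smul_eq_mul p.1.toSeminorm a x)
  mul_le' x y := Real.iSup_le
    (fun p => (p.1.mul_le' x y).trans
      (mul_le_mul (le_ciSup (hS x) p) (le_ciSup (hS y) p) (p.1.nonneg y)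
        (Real.iSup_nonneg fun p => p.1.nonneg x)))
    (mul_nonneg (Real.iSup_nonneg fun p => p.1.nonneg x)
        (Real.iSup_nonneg fun p => p.1.nonneg y))
  star_mul_self' x := by
    change (⨆ p : S, p.1 (star x * x)) = (⨆ p : S, p.1 x) * (⨆ p : S, p.1 x)
    have h0 : 0 ≤ ⨆ p : S, p.1 x := Real.iSup_nonneg fun p => p.1.nonneg x
    apply le_antisymm
    · refine Real.iSup_le (fun p => ?_) (mul_nonneg h0 h0)
      rw [p.1.star_mul_self']
      exact mul_le_mul (le_ciSup (hS x) p) (le_ciSup (hS x) p) (p.1.nonneg x) h0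
    · rw [← sq]
      refine (Real.le_sqrt h0 ?_).mp ?_
      · exact Real.iSup_nonneg fun p => p.1.nonneg _
      · refine Real.iSup_le (fun p => Real.le_sqrt_of_sq_le ?_) (Real.sqrt_nonneg _)
        rw [sq, ← p.1.star_mul_self']
        exact le_ciSup (hS (star x * x)) p

theorem le_sup {S : Set (CStarSeminorm R)} (hS : ∀ x, BddAbove (Set.range fun p : S => p.1 x))
    {p : CStarSeminorm R} (hp : p ∈ S) (x : R) : p x ≤ sup S hS x :=
  le_ciSup (hS x) (⟨p, hp⟩ : S)

theorem sup_le {S : Set (CStarSeminorm R)} (hS : ∀ x, BddAbove (Set.range fun p : S => p.1 x))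
    {x : R} {c : ℝ} (hc : 0 ≤ c) (h : ∀ p ∈ S, p x ≤ c) : sup S hS x ≤ c :=
  Real.iSup_le (fun p => h p.1 p.2) hc

/-- The ⋆-algebra `R`, regarded as a seminormed ⋆-algebra by means of `p`. -/
def Carrier (_p : CStarSeminorm R) : Type _ := R

variable (p : CStarSeminorm R)

instance : Ring p.Carrier := inferInstanceAs (Ring R)
instance : StarRing p.Carrier := inferInstanceAs (StarRing R)
instance : Algebra ℂ p.Carrier := inferInstanceAs (Algebra ℂ R)
instance : StarModule ℂ p.Carrier := inferInstanceAs (StarModule ℂ R)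

instance : SeminormedRing p.Carrier :=
  { (inferInstance : Ring p.Carrier),
    p.toSeminorm.toAddGroupSeminorm.toSeminormedAddCommGroup with
    norm_mul_le := p.mul_le' }

/-- The identity map of `R` as a map to the seminormed ⋆-algebra. -/
def toCarrier : R →⋆ₐ[ℂ] p.Carrier := StarAlgHom.id ℂ R

theorem toCarrier_surjective : Function.Surjective p.toCarrier := fun x => ⟨x, rfl⟩

theorem norm_toCarrier (x : R) : ‖p.toCarrier x‖ = p x := rfl

instance : NormedAlgebra ℂ p.Carrier where
  norm_smul_le a x := (map_smul_eq_mul p.toSeminorm a x).le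

instance : NormedStarGroup p.Carrier where
  norm_star_le x := (p.star_eq x).le

/-- The C⋆-algebra obtained from `R` by dividing out the null space of `p` and completing. -/
abbrev CStarCompletion : Type _ := Completion p.Carrier

theorem uniformContinuous_star : UniformContinuous (star : p.Carrier → p.Carrier) :=
  (starNormedAddGroupHom : NormedAddGroupHom p.Carrier p.Carrier).uniformContinuous

instance : Star p.CStarCompletion where
  star := Completion.map star

theorem star_coe (x : p.Carrier) : star (x : p.CStarCompletion) = ((star x : p.Carrier) : p.CStarCompletion) :=
  Completion.map_coe p.uniformContinuous_star x

theorem continuous_star : Continuous (star : p.CStarCompletion → p.CStarCompletion) :=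
  Completion.continuous_map

instance : CStarAlgebra p.CStarCompletion where
  __ := (inferInstance : NormedRing p.CStarCompletion)
  __ := (inferInstance : Algebra ℂ p.CStarCompletion)
  __ := (inferInstance : CompleteSpace p.CStarCompletion)
  star := star
  star_involutive x := by
    induction x using Completion.induction_on with
    | hp => exact isClosed_eq (p.continuous_star.comp p.continuous_star) continuous_id
    | ih x => rw [star_coe, star_coe, star_star]
  star_mul x y := by
    induction x, y using Completion.induction_on₂ with
    | hp =>
      exact isClosed_eq (p.continuous_star.comp continuous_mul)
        ((p.continuous_star.comp continuous_snd).mul (p.continuous_star.comp continuous_fst))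
    | ih x y => rw [← Completion.coe_mul, star_coe, star_coe, star_coe, star_mul,
        Completion.coe_mul]
  star_add x y := by
    induction x, y using Completion.induction_on₂ with
    | hp =>
      exact isClosed_eq (p.continuous_star.comp continuous_add)
        ((p.continuous_star.comp continuous_fst).add (p.continuous_star.comp continuous_snd))
    | ih x y => rw [← Completion.coe_add, star_coe, star_coe, star_coe, star_add,
        Completion.coe_add]
  norm_mul_self_le x := by
    induction x using Completion.induction_on with
    | hp =>
      exact isClosed_le (continuous_norm.mul continuous_norm)
        (continuous_norm.comp (p.continuous_star.mul continuous_id))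
    | ih x =>
      rw [star_coe, ← Completion.coe_mul, Completion.norm_coe, Completion.norm_coe]
      exact (p.star_mul_self' x).ge
  norm_smul_le a x := norm_smul_le a x
  star_smul a x := by
    induction x using Completion.induction_on with
    | hp =>
      exact isClosed_eq (p.continuous_star.comp (continuous_const_smul a))
        ((continuous_const_smul (star a)).comp p.continuous_star)
    | ih x => rw [← Completion.coe_smul, star_coe, star_coe, star_smul, Completion.coe_smul]

/-- A C⋆-completion carries its usual order, with positive cone `{x⋆ x}`. -/
instance : PartialOrder p.CStarCompletion := CStarAlgebra.spectralOrder _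
instance : StarOrderedRing p.CStarCompletion := CStarAlgebra.spectralOrderedRing _

/-- The canonical ⋆-homomorphism of `R` into the C⋆-completion. -/
def toCompletion : R →⋆ₐ[ℂ] p.CStarCompletion where
  toFun x := (p.toCarrier x : p.CStarCompletion)
  map_one' := by rw [map_one]; rfl
  map_mul' x y := by rw [map_mul, Completion.coe_mul]
  map_zero' := by rw [map_zero]; rfl
  map_add' x y := by rw [map_add, Completion.coe_add]
  commutes' a := by
    rw [AlgHomClass.commutes]
    rfl
  map_star' x := by rw [map_star]; exact (p.star_coe _).symm

theorem norm_toCompletion (x : R) : ‖p.toCompletion x‖ = p x :=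
  Completion.norm_coe _

theorem toCompletion_eq_of {x y : R} (h : p (x - y) = 0) :
    p.toCompletion x = p.toCompletion y := by
  rw [← sub_eq_zero, ← map_sub, ← norm_eq_zero, norm_toCompletion, h]

theorem denseRange_toCompletion : DenseRange p.toCompletion :=
  Completion.denseRange_coe (α := p.Carrier)

theorem completion_hom_ext {B : Type*} [CStarAlgebra B] {f g : p.CStarCompletion →⋆ₐ[ℂ] B}
    (h : ∀ x, f (p.toCompletion x) = g (p.toCompletion x)) : f = g := by
  have hc : ∀ k : p.CStarCompletion →⋆ₐ[ℂ] B, Continuous k := fun k =>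
    (AddMonoidHomClass.lipschitz_of_bound k 1 fun x => by
      rw [one_mul]; exact NonUnitalStarAlgHom.norm_apply_le k x).continuous
  ext x
  exact congrFun (p.denseRange_toCompletion.equalizer (hc f) (hc g) (funext h)) x

section Lift

variable {B : Type*} [CStarAlgebra B] (f : R →⋆ₐ[ℂ] B) (hf : ∀ x, ‖f x‖ ≤ p x)

/-- A ⋆-homomorphism on `R`, regarded as a ring homomorphism on the seminormed copy of `R`. -/
def carrierHom (f : R →⋆ₐ[ℂ] B) : p.Carrier →+* B := f.toAlgHom.toRingHom

theorem continuous_carrierHom (f : R →⋆ₐ[ℂ] B) (hf : ∀ x, ‖f x‖ ≤ p x) :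
    Continuous (p.carrierHom f) :=
  (AddMonoidHomClass.lipschitz_of_bound (p.carrierHom f) 1
    fun x => by rw [one_mul]; exact hf x).continuous

/-- The extension by continuity of a `p`-contractive ⋆-homomorphism to the C⋆-completion. -/
def liftHom : p.CStarCompletion →⋆ₐ[ℂ] B :=
  { Completion.extensionHom (p.carrierHom f) (p.continuous_carrierHom f hf) with
    commutes' a := (Completion.extensionHom_coe _ (p.continuous_carrierHom f hf) _).trans
      (AlgHomClass.commutes f a)
    map_star' x := by
      change Completion.extensionHom _ (p.continuous_carrierHom f hf) (star x) =
        star (Completion.extensionHom _ (p.continuous_carrierHom f hf) x)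
      have hc : Continuous (Completion.extensionHom _ (p.continuous_carrierHom f hf)) :=
        Completion.continuous_extension
      induction x using Completion.induction_on with
      | hp => exact isClosed_eq (hc.comp p.continuous_star) hc.star
      | ih x =>
        rw [star_coe, Completion.extensionHom_coe, Completion.extensionHom_coe]
        exact map_star f x }

@[simp]
theorem liftHom_toCompletion (x : R) : p.liftHom f hf (p.toCompletion x) = f x :=
  Completion.extensionHom_coe _ (p.continuous_carrierHom f hf) (p.toCarrier x)

end Lift

end CStarSeminorm
end Seminorms
/-! ### Representations, unitary equivalence, states and the GNS representation -/

/-- A unital ⋆-representation of a unital C⋆-algebra on a Hilbert space. -/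
structure StarRep (A : Type) [CStarAlgebra A] : Type 1 where
  /-- The Hilbert space of the representation. -/
  H : Type
  [normedAddCommGroup : NormedAddCommGroup H]
  [innerProductSpace : InnerProductSpace ℂ H]
  [completeSpace : CompleteSpace H]
  /-- The ⋆-homomorphism into the bounded operators. -/
  π : A →⋆ₐ[ℂ] (H →L[ℂ] H)

attribute [instance] StarRep.normedAddCommGroup StarRep.innerProductSpace StarRep.completeSpace

section Representations

variable {A B : Type} [CStarAlgebra A] [CStarAlgebra B]

/-- The composition `π ∘ f` of a representation with a unital ⋆-homomorphism. -/
def StarRep.comp (π : StarRep B) (f : A →⋆ₐ[ℂ] B) : StarRep A where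
  H := π.H
  π := π.π.comp f

theorem StarRep.continuous_π (π : StarRep A) : Continuous π.π :=
  (AddMonoidHomClass.lipschitz_of_bound π.π 1 fun x => by
    rw [one_mul]; exact NonUnitalStarAlgHom.norm_apply_le π.π x).continuous

/-- Unitary equivalence of representations. -/
def StarRep.UnitaryEquiv (π₁ π₂ : StarRep A) : Prop :=
  ∃ U : π₁.H ≃ₗᵢ[ℂ] π₂.H, ∀ (a : A) (h : π₁.H), U (π₁.π a h) = π₂.π a (U h)

instance StarRep.setoid (A : Type) [CStarAlgebra A] : Setoid (StarRep A) where
  r := StarRep.UnitaryEquiv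
  iseqv :=
    { refl := fun π => ⟨LinearIsometryEquiv.refl ℂ π.H, fun _ _ => rfl⟩
      symm := fun {π₁ π₂} ⟨U, hU⟩ => ⟨U.symm, fun a h => by
        apply U.injective
        rw [hU, U.apply_symm_apply, U.apply_symm_apply]⟩
      trans := fun ⟨U, hU⟩ ⟨V, hV⟩ => ⟨U.trans V, fun a h => by
        simp only [LinearIsometryEquiv.trans_apply, hU, hV]⟩ }

/-- Unitary equivalence classes of representations. -/
def RepClass (A : Type) [CStarAlgebra A] : Type 1 := Quotient (StarRep.setoid A)

/-- The unitary equivalence class of a representation. -/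
def StarRep.toClass (π : StarRep A) : RepClass A := Quotient.mk _ π

/-- A state of a unital C⋆-algebra: a positive linear functional with value `1` at the unit. -/
@[ext]
structure State (A : Type) [CStarAlgebra A] [PartialOrder A] where
  /-- The underlying positive linear functional. -/
  toPos : A →ₚ[ℂ] ℂ
  map_one' : toPos 1 = 1

instance (A : Type) [CStarAlgebra A] [PartialOrder A] : CoeFun (State A) (fun _ => A → ℂ) :=
  ⟨fun ω => ω.toPos⟩

variable [PartialOrder A] [StarOrderedRing A] [PartialOrder B] [StarOrderedRing B]

/-- The vector state `a ↦ ⟪Ω, π(a) Ω⟫` of a unit vector `Ω`. -/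
def vectorState (π : StarRep A) (Ω : π.H) (hΩ : ‖Ω‖ = 1) : State A where
  toPos := PositiveLinearMap.mk₀
    { toFun := fun a => ⟪Ω, π.π a Ω⟫_ℂ
      map_add' := fun a b => by simp
      map_smul' := fun c a => by simp }
    (fun a ha => by
      obtain ⟨b, rfl⟩ := CStarAlgebra.nonneg_iff_eq_star_mul_self.mp ha
      change (0 : ℂ) ≤ ⟪Ω, π.π (star b * b) Ω⟫_ℂ
      rw [map_mul, map_star, ContinuousLinearMap.star_eq_adjoint,
        mul_apply_eq_comp, ContinuousLinearMap.adjoint_inner_right,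
        inner_self_eq_norm_sq_to_K]
      positivity)
  map_one' := by
    change ⟪Ω, π.π 1 Ω⟫_ℂ = 1
    simp [inner_self_eq_norm_sq_to_K, hΩ]

theorem vectorState_apply (π : StarRep A) (Ω : π.H) (hΩ : ‖Ω‖ = 1) (a : A) :
    vectorState π Ω hΩ a = ⟪Ω, π.π a Ω⟫_ℂ := rfl

/-- The composition `ω ∘ f` of a state with a unital ⋆-homomorphism. -/
def State.comp (ω : State B) (f : A →⋆ₐ[ℂ] B) : State A where
  toPos := PositiveLinearMap.mk₀ (ω.toPos.toLinearMap ∘ₗ (f : A →ₐ[ℂ] B).toLinearMap)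
    (fun a ha => by
      obtain ⟨b, rfl⟩ := CStarAlgebra.nonneg_iff_eq_star_mul_self.mp ha
      change (0 : ℂ) ≤ ω.toPos (f (star b * b))
      rw [map_mul, map_star]
      exact ω.toPos.map_nonneg (star_mul_self_nonneg _))
  map_one' := by
    change ω.toPos (f 1) = 1
    rw [map_one, ω.map_one']

theorem State.comp_apply (ω : State B) (f : A →⋆ₐ[ℂ] B) (a : A) : ω.comp f a = ω (f a) := rfl

/-- The GNS representation of a state. -/
def State.gns (ω : State A) : StarRep A where
  H := ω.toPos.GNS
  π := ω.toPos.gnsStarAlgHom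

/-- The GNS cyclic vector of a state. -/
def State.gnsVec (ω : State A) : ω.gns.H :=
  ((ω.toPos.toPreGNS 1 : ω.toPos.PreGNS) : Completion ω.toPos.PreGNS)

theorem State.inner_gnsVec (ω : State A) (a : A) :
    ⟪ω.gnsVec, ω.gns.π a ω.gnsVec⟫_ℂ = ω a := by
  have h : ω.gns.π a ω.gnsVec = ((ω.toPos.toPreGNS a : ω.toPos.PreGNS) :
      Completion ω.toPos.PreGNS) := by
    change ω.toPos.gnsNonUnitalStarAlgHom a _ = _
    rw [State.gnsVec, PositiveLinearMap.gnsNonUnitalStarAlgHom_apply_coe]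
    simp
  rw [h, State.gnsVec]
  refine (Completion.inner_coe _ _).trans ?_
  rw [PositiveLinearMap.preGNS_inner_def]
  simp

theorem State.norm_gnsVec (ω : State A) : ‖ω.gnsVec‖ = 1 := by
  have h := ω.inner_gnsVec 1
  rw [map_one, one_apply_eq_self, inner_self_eq_norm_sq_to_K, ω.map_one'] at h
  have h2 : ‖ω.gnsVec‖ ^ 2 = 1 := Complex.ofReal_injective (by simpa using h)
  exact (pow_eq_one_iff_of_nonneg (norm_nonneg _) two_ne_zero).mp h2

end Representations

/-! ### The Hilbert space tensor product and the minimal C⋆-tensor product -/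

section HilbertTensor

variable {H₁ H₂ : Type} [NormedAddCommGroup H₁] [InnerProductSpace ℂ H₁]
  [NormedAddCommGroup H₂] [InnerProductSpace ℂ H₂]

/-- The Hilbert space tensor product: the completion of the algebraic tensor product with
respect to the inner product `⟪a ⊗ b, c ⊗ d⟫ = ⟪a, c⟫ ⟪b, d⟫`. -/
def HilbertTensor (H₁ H₂ : Type) [NormedAddCommGroup H₁] [InnerProductSpace ℂ H₁]
    [NormedAddCommGroup H₂] [InnerProductSpace ℂ H₂] : Type :=
  Completion (H₁ ⊗[ℂ] H₂)

instance : NormedAddCommGroup (HilbertTensor H₁ H₂) :=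
  inferInstanceAs (NormedAddCommGroup (Completion (H₁ ⊗[ℂ] H₂)))
instance : InnerProductSpace ℂ (HilbertTensor H₁ H₂) :=
  inferInstanceAs (InnerProductSpace ℂ (Completion (H₁ ⊗[ℂ] H₂)))
instance : CompleteSpace (HilbertTensor H₁ H₂) :=
  inferInstanceAs (CompleteSpace (Completion (H₁ ⊗[ℂ] H₂)))

/-- The canonical isometry of the algebraic into the Hilbert space tensor product. -/
def toHilbertTensor : H₁ ⊗[ℂ] H₂ →ₗᵢ[ℂ] HilbertTensor H₁ H₂ :=
  Completion.toComplₗᵢ (𝕜 := ℂ) (E := H₁ ⊗[ℂ] H₂)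

theorem denseRange_toHilbertTensor :
    DenseRange (toHilbertTensor : H₁ ⊗[ℂ] H₂ →ₗᵢ[ℂ] HilbertTensor H₁ H₂) :=
  Completion.denseRange_coe (α := H₁ ⊗[ℂ] H₂)

/-- The elementary tensor `h₁ ⊗ h₂` in the Hilbert space tensor product. -/
def hTmul (h₁ : H₁) (h₂ : H₂) : HilbertTensor H₁ H₂ := toHilbertTensor (h₁ ⊗ₜ[ℂ] h₂)

theorem inner_hTmul (a c : H₁) (b d : H₂) :
    ⟪hTmul a b, hTmul c d⟫_ℂ = ⟪a, c⟫_ℂ * ⟪b, d⟫_ℂ :=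
  (toHilbertTensor.inner_map_map _ _).trans (TensorProduct.inner_tmul ℂ _ _ _ _)

theorem norm_hTmul (a : H₁) (b : H₂) : ‖hTmul a b‖ = ‖a‖ * ‖b‖ :=
  (toHilbertTensor.norm_map _).trans (TensorProduct.norm_tmul _ _)

theorem hilbertTensor_induction {P : HilbertTensor H₁ H₂ → Prop} (hc : IsClosed {x | P x})
    (h0 : P 0) (htmul : ∀ a b, P (hTmul a b)) (hadd : ∀ x y, P x → P y → P (x + y)) (x) : P x := by
  refine denseRange_toHilbertTensor.induction_on x hc fun y => ?_
  induction y using TensorProduct.induction_on with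
  | zero => rw [map_zero]; exact h0
  | tmul a b => exact htmul a b
  | add x y hx hy => rw [map_add]; exact hadd _ _ hx hy

theorem hilbertTensor_hom_ext {E : Type*} [NormedAddCommGroup E] [NormedSpace ℂ E]
    {S T : HilbertTensor H₁ H₂ →L[ℂ] E} (h : ∀ a b, S (hTmul a b) = T (hTmul a b)) : S = T := by
  ext x
  induction x using hilbertTensor_induction with
  | hc => exact isClosed_eq S.continuous T.continuous
  | h0 => rw [map_zero, map_zero]
  | htmul a b => exact h a b
  | hadd x y hx hy => rw [map_add, map_add, hx, hy]

/-- The bounded operator `S ⊗ T` on the Hilbert space tensor product. -/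
def opTensor {K₁ K₂ : Type} [NormedAddCommGroup K₁] [InnerProductSpace ℂ K₁]
    [NormedAddCommGroup K₂] [InnerProductSpace ℂ K₂] (S : H₁ →L[ℂ] K₁) (T : H₂ →L[ℂ] K₂) :
    HilbertTensor H₁ H₂ →L[ℂ] HilbertTensor K₁ K₂ :=
  (TensorProduct.mapL S T).completion

@[simp]
theorem opTensor_hTmul {K₁ K₂ : Type} [NormedAddCommGroup K₁] [InnerProductSpace ℂ K₁]
    [NormedAddCommGroup K₂] [InnerProductSpace ℂ K₂] (S : H₁ →L[ℂ] K₁) (T : H₂ →L[ℂ] K₂)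
    (a : H₁) (b : H₂) : opTensor S T (hTmul a b) = hTmul (S a) (T b) :=
  ContinuousLinearMap.completion_apply_coe (TensorProduct.mapL S T) (a ⊗ₜ b)

theorem hTmul_add_left (a a' : H₁) (b : H₂) : hTmul (a + a') b = hTmul a b + hTmul a' b := by
  simp only [hTmul, TensorProduct.add_tmul, map_add]

theorem hTmul_add_right (a : H₁) (b b' : H₂) : hTmul a (b + b') = hTmul a b + hTmul a b' := by
  simp only [hTmul, TensorProduct.tmul_add, map_add]

theorem hTmul_smul_left (c : ℂ) (a : H₁) (b : H₂) : hTmul (c • a) b = c • hTmul a b := by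
  simp only [hTmul, ← TensorProduct.smul_tmul', map_smul]

theorem hTmul_smul_right (c : ℂ) (a : H₁) (b : H₂) : hTmul a (c • b) = c • hTmul a b := by
  simp only [hTmul, TensorProduct.tmul_smul, map_smul]

theorem opTensor_adjoint [CompleteSpace H₁] [CompleteSpace H₂]
    (S : H₁ →L[ℂ] H₁) (T : H₂ →L[ℂ] H₂) :
    opTensor (star S) (star T) = star (opTensor S T) := by
  rw [ContinuousLinearMap.star_eq_adjoint (opTensor S T), ContinuousLinearMap.eq_adjoint_iff]
  intro x y
  induction x using hilbertTensor_induction with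
  | hc => apply isClosed_eq <;> fun_prop
  | h0 => rw [map_zero, inner_zero_left, inner_zero_left]
  | hadd x x' hx hx' => rw [map_add, inner_add_left, inner_add_left, hx, hx']
  | htmul a b =>
    induction y using hilbertTensor_induction with
    | hc => apply isClosed_eq <;> fun_prop
    | h0 => rw [map_zero, inner_zero_right, inner_zero_right]
    | hadd y y' hy hy' => rw [map_add, inner_add_right, inner_add_right, hy, hy']
    | htmul c d =>
      simp only [opTensor_hTmul, inner_hTmul, ContinuousLinearMap.star_eq_adjoint,
        ContinuousLinearMap.adjoint_inner_left]

/-- The tensor product of two unitaries. -/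
def hCongr {K₁ K₂ : Type} [NormedAddCommGroup K₁] [InnerProductSpace ℂ K₁]
    [NormedAddCommGroup K₂] [InnerProductSpace ℂ K₂] (U : H₁ ≃ₗᵢ[ℂ] K₁) (V : H₂ ≃ₗᵢ[ℂ] K₂) :
    HilbertTensor H₁ H₂ ≃ₗᵢ[ℂ] HilbertTensor K₁ K₂ where
  toLinearEquiv := LinearEquiv.ofLinearMap
    (opTensor (U : H₁ →L[ℂ] K₁) (V : H₂ →L[ℂ] K₂)).toLinearMap
    (opTensor (U.symm : K₁ →L[ℂ] H₁) (V.symm : K₂ →L[ℂ] H₂)).toLinearMap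
    (congrArg ContinuousLinearMap.toLinearMap (hilbertTensor_hom_ext
      (S := opTensor (U : H₁ →L[ℂ] K₁) (V : H₂ →L[ℂ] K₂) ∘L
        opTensor (U.symm : K₁ →L[ℂ] H₁) (V.symm : K₂ →L[ℂ] H₂)) (T := .id ℂ _) (by simp)))
    (congrArg ContinuousLinearMap.toLinearMap (hilbertTensor_hom_ext
      (S := opTensor (U.symm : K₁ →L[ℂ] H₁) (V.symm : K₂ →L[ℂ] H₂) ∘L
        opTensor (U : H₁ →L[ℂ] K₁) (V : H₂ →L[ℂ] K₂)) (T := .id ℂ _) (by simp)))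
  norm_map' x := by
    change ‖opTensor (U : H₁ →L[ℂ] K₁) (V : H₂ →L[ℂ] K₂) x‖ = ‖x‖
    refine denseRange_toHilbertTensor.induction_on x (isClosed_eq (by fun_prop) (by fun_prop))
      fun y => ?_
    have h : opTensor (U : H₁ →L[ℂ] K₁) (V : H₂ →L[ℂ] K₂) (toHilbertTensor y) =
        toHilbertTensor (TensorProduct.congrIsometry U V y) := by
      induction y using TensorProduct.induction_on with
      | zero => simp only [map_zero]
      | tmul a b => exact opTensor_hTmul (U : H₁ →L[ℂ] K₁) (V : H₂ →L[ℂ] K₂) a b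
      | add x y hx hy => simp only [map_add, hx, hy]
    rw [h, LinearIsometry.norm_map, LinearIsometryEquiv.norm_map, LinearIsometry.norm_map]

theorem hCongr_hTmul {K₁ K₂ : Type} [NormedAddCommGroup K₁] [InnerProductSpace ℂ K₁]
    [NormedAddCommGroup K₂] [InnerProductSpace ℂ K₂] (U : H₁ ≃ₗᵢ[ℂ] K₁) (V : H₂ ≃ₗᵢ[ℂ] K₂)
    (a : H₁) (b : H₂) : hCongr U V (hTmul a b) = hTmul (U a) (V b) :=
  opTensor_hTmul _ _ _ _

end HilbertTensor

section MinTensor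

variable {A B : Type} [CStarAlgebra A] [CStarAlgebra B]

/-- The algebra homomorphism `a ⊗ b ↦ π₁(a) ⊗ π₂(b)` on the algebraic tensor product. -/
def StarRep.algTensorHom (π₁ : StarRep A) (π₂ : StarRep B) :
    A ⊗[ℂ] B →ₐ[ℂ] (HilbertTensor π₁.H π₂.H →L[ℂ] HilbertTensor π₁.H π₂.H) :=
  Algebra.TensorProduct.algHomOfLinearMapTensorProduct
    (TensorProduct.lift (LinearMap.mk₂ ℂ (fun a b => opTensor (π₁.π a) (π₂.π b))
      (fun a a' b => hilbertTensor_hom_ext fun x y => by simp [hTmul_add_left])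
      (fun c a b => hilbertTensor_hom_ext fun x y => by simp [hTmul_smul_left])
      (fun a b b' => hilbertTensor_hom_ext fun x y => by simp [hTmul_add_right])
      (fun c a b => hilbertTensor_hom_ext fun x y => by simp [hTmul_smul_right])))
    (fun a a' b b' => hilbertTensor_hom_ext fun x y => by simp)
    (hilbertTensor_hom_ext fun x y => by simp)

theorem StarRep.algTensorHom_tmul (π₁ : StarRep A) (π₂ : StarRep B) (a : A) (b : B) :
    π₁.algTensorHom π₂ (a ⊗ₜ b) = opTensor (π₁.π a) (π₂.π b) := rfl

theorem StarRep.algTensorHom_star (π₁ : StarRep A) (π₂ : StarRep B) (x : A ⊗[ℂ] B) :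
    π₁.algTensorHom π₂ (star x) = star (π₁.algTensorHom π₂ x) := by
  induction x using TensorProduct.induction_on with
  | zero => rw [star_zero, map_zero, ContinuousLinearMap.star_eq_adjoint, map_zero]
  | tmul a b =>
    rw [TensorProduct.star_tmul, algTensorHom_tmul, algTensorHom_tmul, map_star, map_star,
      opTensor_adjoint]
  | add x y hx hy =>
    rw [star_add, map_add, map_add, hx, hy]
    simp only [ContinuousLinearMap.star_eq_adjoint, map_add]

/-- The ⋆-representation `a ⊗ b ↦ π₁(a) ⊗ π₂(b)` of the algebraic tensor product. -/
def StarRep.algTensor (π₁ : StarRep A) (π₂ : StarRep B) :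
    A ⊗[ℂ] B →⋆ₐ[ℂ] (HilbertTensor π₁.H π₂.H →L[ℂ] HilbertTensor π₁.H π₂.H) :=
  { π₁.algTensorHom π₂ with map_star' := π₁.algTensorHom_star π₂ }

@[simp]
theorem StarRep.algTensor_tmul (π₁ : StarRep A) (π₂ : StarRep B) (a : A) (b : B) :
    π₁.algTensor π₂ (a ⊗ₜ b) = opTensor (π₁.π a) (π₂.π b) := rfl

/-- The C⋆-seminorm `x ↦ ‖(π₁ ⊗ π₂)(x)‖` on the algebraic tensor product. -/
def StarRep.spatialSeminorm (π₁ : StarRep A) (π₂ : StarRep B) : CStarSeminorm (A ⊗[ℂ] B) :=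
  CStarSeminorm.ofHom (B := HilbertTensor π₁.H π₂.H →L[ℂ] HilbertTensor π₁.H π₂.H)
    (π₁.algTensor π₂)

/-- The C⋆-seminorms `x ↦ ‖(π₁ ⊗ π₂)(x)‖` on the algebraic tensor product, where `π₁` and `π₂`
are representations of the two factors on Hilbert spaces. -/
def spatialSeminorms (A B : Type) [CStarAlgebra A] [CStarAlgebra B] :
    Set (CStarSeminorm (A ⊗[ℂ] B)) :=
  {p | ∃ (π₁ : StarRep A) (π₂ : StarRep B), p = π₁.spatialSeminorm π₂}

theorem bddAbove_spatialSeminorms (x : A ⊗[ℂ] B) :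
    BddAbove (Set.range fun p : spatialSeminorms A B => p.1 x) := by
  suffices h : ∃ C : ℝ, ∀ p ∈ spatialSeminorms A B, p x ≤ C by
    obtain ⟨C, hC⟩ := h
    exact ⟨C, by rintro _ ⟨p, rfl⟩; exact hC p.1 p.2⟩
  induction x using TensorProduct.induction_on with
  | zero => exact ⟨0, fun p _ => (map_zero p.toSeminorm).le⟩
  | add x y hx hy =>
    obtain ⟨C, hC⟩ := hx
    obtain ⟨D, hD⟩ := hy
    exact ⟨C + D, fun p hp => (map_add_le_add p.toSeminorm x y).trans
      (add_le_add (hC p hp) (hD p hp))⟩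
  | tmul a b =>
    refine ⟨‖a‖ * ‖b‖, ?_⟩
    rintro p ⟨π₁, π₂, rfl⟩
    change ‖π₁.algTensor π₂ (a ⊗ₜ b)‖ ≤ _
    have h : π₁.algTensor π₂ (a ⊗ₜ b) = π₁.algTensor π₂ (a ⊗ₜ 1) * π₁.algTensor π₂ (1 ⊗ₜ b) := by
      rw [← map_mul]; simp
    let f : A →⋆ₐ[ℂ] (HilbertTensor π₁.H π₂.H →L[ℂ] HilbertTensor π₁.H π₂.H) :=
      { ((π₁.algTensor π₂).toAlgHom.comp Algebra.TensorProduct.includeLeft) with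
        map_star' := fun x => by
          change π₁.algTensor π₂ (star x ⊗ₜ 1) = star (π₁.algTensor π₂ (x ⊗ₜ 1))
          rw [← map_star]; simp }
    let g : B →⋆ₐ[ℂ] (HilbertTensor π₁.H π₂.H →L[ℂ] HilbertTensor π₁.H π₂.H) :=
      { ((π₁.algTensor π₂).toAlgHom.comp Algebra.TensorProduct.includeRight) with
        map_star' := fun x => by
          change π₁.algTensor π₂ (1 ⊗ₜ star x) = star (π₁.algTensor π₂ (1 ⊗ₜ x))
          rw [← map_star]; simp }
    have hf : ‖π₁.algTensor π₂ (a ⊗ₜ 1)‖ ≤ ‖a‖ := NonUnitalStarAlgHom.norm_apply_le f a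
    have hg : ‖π₁.algTensor π₂ (1 ⊗ₜ b)‖ ≤ ‖b‖ := NonUnitalStarAlgHom.norm_apply_le g b
    rw [h]
    exact (norm_mul_le _ _).trans (mul_le_mul hf hg (norm_nonneg _) (norm_nonneg _))

/-- The minimal (spatial) C⋆-norm on the algebraic tensor product, i.e. the supremum of
`‖(π₁ ⊗ π₂)(x)‖` over all representations `π₁`, `π₂` of the factors. -/
def minSeminorm (A B : Type) [CStarAlgebra A] [CStarAlgebra B] : CStarSeminorm (A ⊗[ℂ] B) :=
  CStarSeminorm.sup (spatialSeminorms A B) bddAbove_spatialSeminorms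

/-- The minimal C⋆-tensor product. -/
def MinTensor (A B : Type) [CStarAlgebra A] [CStarAlgebra B] : Type :=
  (minSeminorm A B).CStarCompletion

instance : CStarAlgebra (MinTensor A B) :=
  inferInstanceAs (CStarAlgebra (minSeminorm A B).CStarCompletion)
instance : PartialOrder (MinTensor A B) :=
  inferInstanceAs (PartialOrder (minSeminorm A B).CStarCompletion)
instance : StarOrderedRing (MinTensor A B) :=
  inferInstanceAs (StarOrderedRing (minSeminorm A B).CStarCompletion)

/-- The canonical ⋆-homomorphism of the algebraic into the minimal C⋆-tensor product. -/
def toMinTensor (A B : Type) [CStarAlgebra A] [CStarAlgebra B] : A ⊗[ℂ] B →⋆ₐ[ℂ] MinTensor A B :=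
  (minSeminorm A B).toCompletion

theorem denseRange_toMinTensor : DenseRange (toMinTensor A B) :=
  (minSeminorm A B).denseRange_toCompletion

/-- The elementary tensor `a ⊗ b` in the minimal C⋆-tensor product. -/
def minTmul (a : A) (b : B) : MinTensor A B := toMinTensor A B (a ⊗ₜ b)

theorem minTensor_induction {P : MinTensor A B → Prop} (hc : IsClosed {x | P x})
    (h0 : P 0) (htmul : ∀ a b, P (minTmul a b)) (hadd : ∀ x y, P x → P y → P (x + y)) (x) :
    P x := by
  refine denseRange_toMinTensor.induction_on x hc fun y => ?_
  induction y using TensorProduct.induction_on with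
  | zero => rw [map_zero]; exact h0
  | tmul a b => exact htmul a b
  | add x y hx hy => rw [map_add]; exact hadd _ _ hx hy

theorem minTmul_mul (a a' : A) (b b' : B) :
    minTmul a b * minTmul a' b' = minTmul (a * a') (b * b') := by
  simp only [minTmul, ← map_mul, Algebra.TensorProduct.tmul_mul_tmul]

theorem star_minTmul (a : A) (b : B) : star (minTmul a b) = minTmul (star a) (star b) := by
  simp only [minTmul, ← map_star, TensorProduct.star_tmul]

theorem minTmul_one_one : minTmul (1 : A) (1 : B) = 1 := by
  rw [minTmul, ← Algebra.TensorProduct.one_def, map_one]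

theorem StarRep.norm_algTensor_le (π₁ : StarRep A) (π₂ : StarRep B) (x : A ⊗[ℂ] B) :
    ‖π₁.algTensor π₂ x‖ ≤ minSeminorm A B x :=
  CStarSeminorm.le_sup bddAbove_spatialSeminorms (p := π₁.spatialSeminorm π₂) ⟨π₁, π₂, rfl⟩ x

/-- The ⋆-homomorphism `a ⊗ b ↦ π₁(a) ⊗ π₂(b)` on the minimal C⋆-tensor product. -/
def StarRep.tensorHom (π₁ : StarRep A) (π₂ : StarRep B) :
    MinTensor A B →⋆ₐ[ℂ] (HilbertTensor π₁.H π₂.H →L[ℂ] HilbertTensor π₁.H π₂.H) :=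
  (minSeminorm A B).liftHom (π₁.algTensor π₂) (π₁.norm_algTensor_le π₂)

theorem StarRep.tensorHom_minTmul (π₁ : StarRep A) (π₂ : StarRep B) (a : A) (b : B) :
    π₁.tensorHom π₂ (minTmul a b) = opTensor (π₁.π a) (π₂.π b) :=
  CStarSeminorm.liftHom_toCompletion _ (π₁.algTensor π₂) (π₁.norm_algTensor_le π₂) _

/-- The tensor product `π₁ ⊗ π₂` of representations, as a representation of the minimal
C⋆-tensor product. -/
def StarRep.tensor (π₁ : StarRep A) (π₂ : StarRep B) : StarRep (MinTensor A B) where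
  H := HilbertTensor π₁.H π₂.H
  π := π₁.tensorHom π₂

/-- The elementary tensor `h₁ ⊗ h₂`, as a vector of the Hilbert space of `π₁ ⊗ π₂`. -/
def StarRep.tensorVec (π₁ : StarRep A) (π₂ : StarRep B) (h₁ : π₁.H) (h₂ : π₂.H) :
    (π₁.tensor π₂).H := hTmul h₁ h₂

theorem StarRep.inner_tensorVec (π₁ : StarRep A) (π₂ : StarRep B) (h₁ k₁ : π₁.H)
    (h₂ k₂ : π₂.H) :
    ⟪π₁.tensorVec π₂ h₁ h₂, π₁.tensorVec π₂ k₁ k₂⟫_ℂ = ⟪h₁, k₁⟫_ℂ * ⟪h₂, k₂⟫_ℂ :=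
  inner_hTmul _ _ _ _

theorem StarRep.norm_tensorVec (π₁ : StarRep A) (π₂ : StarRep B) (h₁ : π₁.H) (h₂ : π₂.H) :
    ‖π₁.tensorVec π₂ h₁ h₂‖ = ‖h₁‖ * ‖h₂‖ :=
  norm_hTmul _ _

theorem StarRep.tensor_π_tensorVec (π₁ : StarRep A) (π₂ : StarRep B) (a : A) (b : B)
    (h₁ : π₁.H) (h₂ : π₂.H) :
    (π₁.tensor π₂).π (minTmul a b) (π₁.tensorVec π₂ h₁ h₂) =
      π₁.tensorVec π₂ (π₁.π a h₁) (π₂.π b h₂) := by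
  refine (congrArg (fun T => T (hTmul h₁ h₂)) (π₁.tensorHom_minTmul π₂ a b)).trans ?_
  exact opTensor_hTmul _ _ _ _

theorem StarRep.hCongr_tensorHom {π₁ π₁' : StarRep A} {π₂ π₂' : StarRep B}
    (U : π₁.H ≃ₗᵢ[ℂ] π₁'.H) (hU : ∀ a h, U (π₁.π a h) = π₁'.π a (U h))
    (V : π₂.H ≃ₗᵢ[ℂ] π₂'.H) (hV : ∀ b h, V (π₂.π b h) = π₂'.π b (V h))
    (x : MinTensor A B) (h : HilbertTensor π₁.H π₂.H) :
    hCongr U V (π₁.tensorHom π₂ x h) = π₁'.tensorHom π₂' x (hCongr U V h) := by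
  have hW : Continuous (hCongr U V) := (hCongr U V).continuous
  have hL : Continuous (π₁.tensorHom π₂) := (π₁.tensor π₂).continuous_π
  have hR : Continuous (π₁'.tensorHom π₂') := (π₁'.tensor π₂').continuous_π
  induction x using minTensor_induction with
  | hc =>
    exact isClosed_eq (hW.comp (hL.clm_apply continuous_const)) (hR.clm_apply continuous_const)
  | h0 => simp
  | hadd x y hx hy =>
    rw [map_add, map_add, add_apply, add_apply, map_add, hx, hy]
  | htmul a b =>
    rw [tensorHom_minTmul, tensorHom_minTmul]
    induction h using hilbertTensor_induction with
    | hc => exact isClosed_eq (hW.comp (opTensor _ _).continuous) ((opTensor _ _).continuous.comp hW)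
    | h0 => simp only [map_zero]
    | htmul x y => rw [opTensor_hTmul, hCongr_hTmul, hCongr_hTmul, opTensor_hTmul, hU, hV]
    | hadd x y hx hy => simp only [map_add, hx, hy]

theorem StarRep.tensor_congr {π₁ π₁' : StarRep A} {π₂ π₂' : StarRep B}
    (h₁ : π₁.UnitaryEquiv π₁') (h₂ : π₂.UnitaryEquiv π₂') :
    (π₁.tensor π₂).UnitaryEquiv (π₁'.tensor π₂') := by
  obtain ⟨U, hU⟩ := h₁
  obtain ⟨V, hV⟩ := h₂
  exact ⟨hCongr U V, StarRep.hCongr_tensorHom U hU V hV⟩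

section States

variable [PartialOrder A] [StarOrderedRing A] [PartialOrder B] [StarOrderedRing B]

/-- The product state `ω ⊗ ω'` on the minimal C⋆-tensor product, realised as the vector state
of `Ω ⊗ Ω'` in the tensor product of the GNS representations. It is the continuous linear
functional with `(ω ⊗ ω')(a ⊗ b) = ω(a) ω'(b)`, see `State.tensor_minTmul`. -/
def State.tensor (ω : State A) (ω' : State B) : State (MinTensor A B) :=
  vectorState (ω.gns.tensor ω'.gns) (ω.gns.tensorVec ω'.gns ω.gnsVec ω'.gnsVec)
    (by rw [StarRep.norm_tensorVec, ω.norm_gnsVec, ω'.norm_gnsVec, one_mul])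

theorem State.tensor_minTmul (ω : State A) (ω' : State B) (a : A) (b : B) :
    ω.tensor ω' (minTmul a b) = ω a * ω' b := by
  rw [State.tensor, vectorState_apply, StarRep.tensor_π_tensorVec, StarRep.inner_tensorVec,
    ω.inner_gnsVec, ω'.inner_gnsVec]

end States

end MinTensor

/-! ### The free ⋆-algebra -/

section FreeStar

variable (X : Type)

/-- The free unital complex ⋆-algebra on `X`: the algebra of noncommutative polynomials in the
letters `x = (x, false)` and `x⋆ = (x, true)`. -/
def FreeStarAlgebra : Type := MonoidAlgebra ℂ (FreeMonoid (X × Bool))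

instance : Ring (FreeStarAlgebra X) :=
  inferInstanceAs (Ring (MonoidAlgebra ℂ (FreeMonoid (X × Bool))))
instance : Algebra ℂ (FreeStarAlgebra X) :=
  inferInstanceAs (Algebra ℂ (MonoidAlgebra ℂ (FreeMonoid (X × Bool))))

variable {X}

/-- The monomial `c • w`. -/
def monomial (w : FreeMonoid (X × Bool)) (c : ℂ) : FreeStarAlgebra X := MonoidAlgebra.single w c

/-- The adjoint of a word: reverse it and exchange `x` and `x⋆`. -/
def wordAdj (w : FreeMonoid (X × Bool)) : FreeMonoid (X × Bool) :=
  star (FreeMonoid.map (fun l => (l.1, !l.2)) w)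

theorem wordAdj_mul (v w : FreeMonoid (X × Bool)) : wordAdj (v * w) = wordAdj w * wordAdj v := by
  simp [wordAdj]

theorem wordAdj_wordAdj (w : FreeMonoid (X × Bool)) : wordAdj (wordAdj w) = w := by
  induction w using FreeMonoid.inductionOn' with
  | one => simp [wordAdj]
  | of_mul x w ih => rw [wordAdj_mul, wordAdj_mul, ih]; simp [wordAdj]

theorem freeStar_induction {P : FreeStarAlgebra X → Prop} (h0 : P 0)
    (hadd : ∀ x y, P x → P y → P (x + y)) (hm : ∀ w c, P (monomial w c)) (x) : P x :=
  MonoidAlgebra.induction_linear x h0 hadd hm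

theorem monomial_mul (v w : FreeMonoid (X × Bool)) (c d : ℂ) :
    monomial v c * monomial w d = monomial (v * w) (c * d) :=
  MonoidAlgebra.single_mul_single _ _ _ _

theorem smul_monomial (w : FreeMonoid (X × Bool)) (c d : ℂ) :
    c • monomial w d = monomial w (c * d) :=
  MonoidAlgebra.smul_single _ _ _

/-- The involution of the free ⋆-algebra, as an additive map. -/
def freeStar : FreeStarAlgebra X →+ FreeStarAlgebra X :=
  (MonoidAlgebra.liftNC (k := ℂ) (R := FreeStarAlgebra X)
    ((algebraMap ℂ (FreeStarAlgebra X)).comp (starRingEnd ℂ) : ℂ →+ FreeStarAlgebra X)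
    (fun w => monomial (wordAdj w) 1))

theorem freeStar_monomial (w : FreeMonoid (X × Bool)) (c : ℂ) :
    freeStar (monomial w c) = monomial (wordAdj w) (star c) := by
  refine (MonoidAlgebra.liftNC_single _ _ _ _).trans ?_
  change algebraMap ℂ (FreeStarAlgebra X) (star c) * _ = _
  rw [← Algebra.smul_def, smul_monomial, mul_one]

instance : StarRing (FreeStarAlgebra X) where
  star := freeStar
  star_involutive x := by
    induction x using freeStar_induction with
    | h0 => rw [map_zero, map_zero]
    | hadd x y hx hy => rw [map_add, map_add, hx, hy]
    | hm w c => rw [freeStar_monomial, freeStar_monomial, wordAdj_wordAdj, star_star]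
  star_mul x y := by
    induction x using freeStar_induction with
    | h0 => simp only [zero_mul, map_zero, mul_zero]
    | hadd x x' hx hx' => simp only [add_mul, mul_add, map_add, hx, hx']
    | hm v c =>
      induction y using freeStar_induction with
      | h0 => simp only [zero_mul, map_zero, mul_zero]
      | hadd x x' hx hx' => simp only [add_mul, mul_add, map_add, hx, hx']
      | hm w d =>
        rw [monomial_mul, freeStar_monomial, freeStar_monomial, freeStar_monomial, monomial_mul,
          wordAdj_mul, star_mul]
  star_add x y := map_add freeStar x y

theorem star_monomial (w : FreeMonoid (X × Bool)) (c : ℂ) :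
    star (monomial w c) = monomial (wordAdj w) (star c) := freeStar_monomial w c

instance : StarModule ℂ (FreeStarAlgebra X) where
  star_smul a x := by
    induction x using freeStar_induction with
    | h0 => simp only [star_zero, smul_zero]
    | hadd x y hx hy => rw [smul_add, star_add, star_add, smul_add, hx, hy]
    | hm w c => rw [smul_monomial, star_monomial, star_monomial, smul_monomial, star_mul, mul_comm]

/-- The generator `x` of the free ⋆-algebra. -/
def freeGen (x : X) : FreeStarAlgebra X := monomial (FreeMonoid.of (x, false)) 1

theorem star_freeGen (x : X) : star (freeGen x) = monomial (FreeMonoid.of (x, true)) 1 := by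
  rw [freeGen, star_monomial, star_one]; rfl

theorem monomial_one : monomial (1 : FreeMonoid (X × Bool)) 1 = 1 := rfl

/-- Induction on words: every element is a linear combination of products of generators and
their adjoints. -/
theorem freeStar_induction' {P : FreeStarAlgebra X → Prop} (h0 : P 0) (h1 : P 1)
    (hadd : ∀ x y, P x → P y → P (x + y)) (hsmul : ∀ (c : ℂ) x, P x → P (c • x))
    (hgen : ∀ i x, P x → P (freeGen i * x)) (hstar : ∀ i x, P x → P (star (freeGen i) * x))
    (x) : P x := by
  induction x using freeStar_induction with
  | h0 => exact h0
  | hadd x y hx hy => exact hadd x y hx hy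
  | hm w c =>
    have : monomial w c = c • monomial w 1 := by rw [smul_monomial, mul_one]
    rw [this]
    apply hsmul
    clear this
    induction w using FreeMonoid.inductionOn' with
    | one => exact h1
    | of_mul l w ih =>
      obtain ⟨i, b⟩ := l
      cases b with
      | false =>
        have h := hgen i _ ih
        rwa [freeGen, monomial_mul, mul_one] at h
      | true =>
        have h := hstar i _ ih
        rwa [star_freeGen, monomial_mul, mul_one] at h

variable {B : Type*} [CStarAlgebra B]

/-- The ⋆-homomorphism on the free ⋆-algebra that sends the generators to given elements. -/
def freeLift (b : X → B) : FreeStarAlgebra X →⋆ₐ[ℂ] B :=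
  let f : FreeStarAlgebra X →ₐ[ℂ] B := MonoidAlgebra.lift ℂ B (FreeMonoid (X × Bool))
    (FreeMonoid.lift fun l => if l.2 then star (b l.1) else b l.1)
  have hf : ∀ w c, f (monomial w c) =
      c • FreeMonoid.lift (fun l : X × Bool => if l.2 then star (b l.1) else b l.1) w :=
    fun w c => MonoidAlgebra.lift_single _ _ _
  { f with
    map_star' x := by
      change f (star x) = star (f x)
      have hw : ∀ w : FreeMonoid (X × Bool), f (monomial (wordAdj w) 1) =
          star (f (monomial w 1)) := by
        intro w
        induction w using FreeMonoid.inductionOn' with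
        | one =>
          change f 1 = star (f 1)
          rw [map_one, star_one]
        | of_mul l w ih =>
          rw [wordAdj_mul]
          have h1 : monomial (wordAdj w * wordAdj (FreeMonoid.of l)) 1 =
            monomial (wordAdj w) 1 * monomial (wordAdj (FreeMonoid.of l)) 1 := by
              rw [monomial_mul, mul_one]
          have h2 : monomial (FreeMonoid.of l * w) 1 =
            monomial (FreeMonoid.of l) 1 * monomial w 1 := by
              rw [monomial_mul, mul_one]
          rw [h1, h2, map_mul, map_mul, star_mul, ih, hf (wordAdj (FreeMonoid.of l)),
            hf (FreeMonoid.of l)]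
          obtain ⟨i, t⟩ := l
          cases t <;> simp [wordAdj]
      induction x using freeStar_induction with
      | h0 => rw [star_zero, map_zero, star_zero]
      | hadd x y hx hy => rw [star_add, map_add, map_add, star_add, hx, hy]
      | hm w c =>
        have h1 : ∀ (w : FreeMonoid (X × Bool)) (c : ℂ), monomial w c = c • monomial w 1 :=
          fun w c => by rw [smul_monomial, mul_one]
        rw [star_monomial, h1, map_smul, hw, h1 w c, map_smul, star_smul] }

@[simp]
theorem freeLift_freeGen (b : X → B) (x : X) : freeLift b (freeGen x) = b x := by
  refine (MonoidAlgebra.lift_single _ _ _).trans ?_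
  simp

end FreeStar

/-! ### The Cuntz algebras -/

section Cuntz

/-- The defining relations of `O_n`: `bᵢ⋆ bⱼ = δᵢⱼ 1` and `∑ bᵢ bᵢ⋆ = 1`. For `n = 1` the relation
`b₁ = 1` is added, which makes the universal algebra `O_1` equal to `ℂ`. -/
structure IsCuntzFamily {n : ℕ} {B : Type*} [CStarAlgebra B] (b : Fin n → B) : Prop where
  star_mul : ∀ i j, star (b i) * b j = if i = j then 1 else 0
  sum_mul_star : ∑ i, b i * star (b i) = 1
  eq_one : n = 1 → ∀ i, b i = 1

/-- The C⋆-seminorms on the free ⋆-algebra on `n` generators that vanish on the relations. -/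
def cuntzSeminorms (n : ℕ) : Set (CStarSeminorm (FreeStarAlgebra (Fin n))) :=
  {p | (∀ i j, p (star (freeGen i) * freeGen j - if i = j then 1 else 0) = 0) ∧
    p (∑ i, freeGen i * star (freeGen i) - 1) = 0 ∧
    (n = 1 → ∀ i, p (freeGen i - 1) = 0)}

theorem cuntzSeminorms_gen_le {n : ℕ} {p : CStarSeminorm (FreeStarAlgebra (Fin n))}
    (hp : p ∈ cuntzSeminorms n) (i : Fin n) : p (freeGen i) ≤ 1 := by
  have h1 := hp.1 i i
  rw [if_pos rfl] at h1
  have h2 : p (star (freeGen i) * freeGen i) ≤ p (star (freeGen i) * freeGen i - 1) + p 1 := by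
    simpa using map_add_le_add p.toSeminorm (star (freeGen i) * freeGen i - 1) 1
  rw [h1, p.star_mul_self'] at h2
  have h3 := p.one_le
  have h4 := p.nonneg (freeGen i)
  nlinarith

theorem bddAbove_cuntzSeminorms {n : ℕ} (x : FreeStarAlgebra (Fin n)) :
    BddAbove (Set.range fun p : cuntzSeminorms n => p.1 x) := by
  suffices h : ∃ C : ℝ, ∀ p ∈ cuntzSeminorms n, p x ≤ C by
    obtain ⟨C, hC⟩ := h
    exact ⟨C, by rintro _ ⟨p, rfl⟩; exact hC p.1 p.2⟩
  have hmul : ∀ p ∈ cuntzSeminorms n, ∀ g, p g ≤ 1 → ∀ x, p (g * x) ≤ p x := fun p _ g hg x =>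
    (p.mul_le' g x).trans (mul_le_of_le_one_left (p.nonneg x) hg)
  induction x using freeStar_induction' with
  | h0 => exact ⟨0, fun p _ => (map_zero p.toSeminorm).le⟩
  | h1 => exact ⟨1, fun p _ => p.one_le⟩
  | hadd x y hx hy =>
    obtain ⟨C, hC⟩ := hx
    obtain ⟨D, hD⟩ := hy
    exact ⟨C + D, fun p hp => (map_add_le_add p.toSeminorm x y).trans
      (add_le_add (hC p hp) (hD p hp))⟩
  | hsmul c x hx =>
    obtain ⟨C, hC⟩ := hx
    exact ⟨‖c‖ * C, fun p hp => (map_smul_eq_mul p.toSeminorm c x).le.trans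
      (mul_le_mul_of_nonneg_left (hC p hp) (norm_nonneg c))⟩
  | hgen i x hx =>
    obtain ⟨C, hC⟩ := hx
    exact ⟨C, fun p hp => (hmul p hp _ (cuntzSeminorms_gen_le hp i) x).trans (hC p hp)⟩
  | hstar i x hx =>
    obtain ⟨C, hC⟩ := hx
    exact ⟨C, fun p hp => (hmul p hp _ ((p.star_eq _).le.trans (cuntzSeminorms_gen_le hp i))
      x).trans (hC p hp)⟩

/-- The universal C⋆-seminorm for the Cuntz relations. -/
def cuntzSeminorm (n : ℕ) : CStarSeminorm (FreeStarAlgebra (Fin n)) :=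
  CStarSeminorm.sup (cuntzSeminorms n) bddAbove_cuntzSeminorms

/-- The Cuntz algebra `O_n` (with `O_1 = ℂ`): the universal unital C⋆-algebra generated by a
Cuntz family `s₁, …, sₙ`. -/
def CuntzAlgebra (n : ℕ) : Type := (cuntzSeminorm n).CStarCompletion

instance (n : ℕ) : CStarAlgebra (CuntzAlgebra n) :=
  inferInstanceAs (CStarAlgebra (cuntzSeminorm n).CStarCompletion)
instance (n : ℕ) : PartialOrder (CuntzAlgebra n) :=
  inferInstanceAs (PartialOrder (cuntzSeminorm n).CStarCompletion)
instance (n : ℕ) : StarOrderedRing (CuntzAlgebra n) :=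
  inferInstanceAs (StarOrderedRing (cuntzSeminorm n).CStarCompletion)

/-- The canonical ⋆-homomorphism of the free ⋆-algebra onto a dense ⋆-subalgebra of `O_n`. -/
def toCuntz (n : ℕ) : FreeStarAlgebra (Fin n) →⋆ₐ[ℂ] CuntzAlgebra n :=
  (cuntzSeminorm n).toCompletion

theorem denseRange_toCuntz (n : ℕ) : DenseRange (toCuntz n) :=
  (cuntzSeminorm n).denseRange_toCompletion

/-- The canonical generators of `O_n`. -/
def cuntzGen {n : ℕ} (i : Fin n) : CuntzAlgebra n := toCuntz n (freeGen i)

theorem isCuntzFamily_cuntzGen (n : ℕ) : IsCuntzFamily (cuntzGen : Fin n → CuntzAlgebra n) where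
  star_mul i j := by
    have h : toCuntz n (star (freeGen i) * freeGen j) = toCuntz n (if i = j then 1 else 0) :=
      (cuntzSeminorm n).toCompletion_eq_of
        (le_antisymm (CStarSeminorm.sup_le _ le_rfl fun p hp => (hp.1 i j).le)
          (CStarSeminorm.nonneg _ _))
    rw [map_mul, map_star] at h
    refine h.trans ?_
    split_ifs
    · exact map_one _
    · exact map_zero _
  sum_mul_star := by
    have h : toCuntz n (∑ i, freeGen i * star (freeGen i)) = toCuntz n 1 :=
      (cuntzSeminorm n).toCompletion_eq_of
        (le_antisymm (CStarSeminorm.sup_le _ le_rfl fun p hp => hp.2.1.le)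
          (CStarSeminorm.nonneg _ _))
    simpa only [map_sum, map_mul, map_star, map_one, ← cuntzGen.eq_1] using h
  eq_one hn i := by
    have h : toCuntz n (freeGen i) = toCuntz n 1 :=
      (cuntzSeminorm n).toCompletion_eq_of
        (le_antisymm (CStarSeminorm.sup_le _ le_rfl fun p hp => (hp.2.2 hn i).le)
          (CStarSeminorm.nonneg _ _))
    rwa [map_one] at h

section Lift

variable {n : ℕ} {B : Type*} [CStarAlgebra B] (b : Fin n → B)

theorem norm_freeLift_le (hb : IsCuntzFamily b) (x : FreeStarAlgebra (Fin n)) :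
    ‖freeLift b x‖ ≤ cuntzSeminorm n x := by
  refine CStarSeminorm.le_sup bddAbove_cuntzSeminorms (p := CStarSeminorm.ofHom (freeLift b))
    ⟨fun i j => ?_, ?_, fun hn i => ?_⟩ x
  · rw [CStarSeminorm.ofHom_apply, map_sub, map_mul, map_star, freeLift_freeGen,
      freeLift_freeGen, hb.star_mul]
    split_ifs <;> simp
  · rw [CStarSeminorm.ofHom_apply, map_sub, map_sum]
    simp only [map_mul, map_star, freeLift_freeGen, hb.sum_mul_star, map_one, sub_self, norm_zero]
  · rw [CStarSeminorm.ofHom_apply, map_sub, map_one, freeLift_freeGen, hb.eq_one hn, sub_self,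
      norm_zero]

/-- The universal property of the Cuntz algebra. -/
def cuntzLift (hb : IsCuntzFamily b) : CuntzAlgebra n →⋆ₐ[ℂ] B :=
  (cuntzSeminorm n).liftHom (freeLift b) (norm_freeLift_le b hb)

@[simp]
theorem cuntzLift_cuntzGen (hb : IsCuntzFamily b) (i : Fin n) :
    cuntzLift b hb (cuntzGen i) = b i :=
  ((cuntzSeminorm n).liftHom_toCompletion (freeLift b) (norm_freeLift_le b hb) _).trans
    (freeLift_freeGen b i)

end Lift

/-- The elements `sᵢ⁽ⁿ⁾ ⊗ sⱼ⁽ᵐ⁾` of `O_n ⊗ O_m`, listed so that (with indices starting at `1`)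
the one with number `m (i - 1) + j` is `sᵢ ⊗ sⱼ`. -/
def phiGen (n m : ℕ) (k : Fin (n * m)) : MinTensor (CuntzAlgebra n) (CuntzAlgebra m) :=
  minTmul (cuntzGen (finProdFinEquiv.symm k).1) (cuntzGen (finProdFinEquiv.symm k).2)

theorem minTmul_sum_sum {A B : Type} [CStarAlgebra A] [CStarAlgebra B] {ι κ : Type*} [Fintype ι]
    [Fintype κ] (f : ι → A) (g : κ → B) :
    minTmul (∑ i, f i) (∑ j, g j) = ∑ i, ∑ j, minTmul (f i) (g j) := by
  simp only [minTmul, TensorProduct.sum_tmul, TensorProduct.tmul_sum, map_sum]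
  exact Finset.sum_comm

theorem isCuntzFamily_phiGen (n m : ℕ) : IsCuntzFamily (phiGen n m) where
  star_mul k l := by
    simp only [phiGen, star_minTmul, minTmul_mul, (isCuntzFamily_cuntzGen _).star_mul]
    simp only [← finProdFinEquiv.symm.injective.eq_iff (a := k), Prod.ext_iff]
    by_cases h1 : (finProdFinEquiv.symm k).1 = (finProdFinEquiv.symm l).1 <;>
    by_cases h2 : (finProdFinEquiv.symm k).2 = (finProdFinEquiv.symm l).2 <;>
    simp only [h1, h2, if_true, if_false, and_self, and_true, and_false, minTmul_one_one] <;>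
    simp [minTmul]
  sum_mul_star := by
    rw [← finProdFinEquiv.sum_comp, Fintype.sum_prod_type]
    simp only [phiGen, Equiv.symm_apply_apply, star_minTmul, minTmul_mul]
    rw [← minTmul_sum_sum, (isCuntzFamily_cuntzGen n).sum_mul_star,
      (isCuntzFamily_cuntzGen m).sum_mul_star, minTmul_one_one]
  eq_one h k := by
    obtain ⟨hn, hm⟩ := mul_eq_one.mp h
    rw [phiGen, (isCuntzFamily_cuntzGen n).eq_one hn, (isCuntzFamily_cuntzGen m).eq_one hm,
      minTmul_one_one]

/-- The embedding `φ_{n,m} : O_{nm} → O_n ⊗ O_m`, `s_{m(i-1)+j} ↦ sᵢ ⊗ sⱼ`. -/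
def phi (n m : ℕ) : CuntzAlgebra (n * m) →⋆ₐ[ℂ] MinTensor (CuntzAlgebra n) (CuntzAlgebra m) :=
  cuntzLift (phiGen n m) (isCuntzFamily_phiGen n m)

theorem phi_cuntzGen {n m : ℕ} (i : Fin n) (j : Fin m) :
    phi n m (cuntzGen (finProdFinEquiv (i, j))) = minTmul (cuntzGen i) (cuntzGen j) := by
  rw [phi, cuntzLift_cuntzGen, phiGen, Equiv.symm_apply_apply]

variable {n m : ℕ}

/-- The product `π₁ ⊗_φ π₂ = (π₁ ⊗ π₂) ∘ φ_{n,m}` of representations of Cuntz algebras. -/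
def StarRep.phiTensor (π₁ : StarRep (CuntzAlgebra n)) (π₂ : StarRep (CuntzAlgebra m)) :
    StarRep (CuntzAlgebra (n * m)) :=
  (π₁.tensor π₂).comp (phi n m)

/-- The product `[π₁] ⊗_φ [π₂] = [π₁ ⊗_φ π₂]` of unitary equivalence classes. -/
def RepClass.phiTensor (c₁ : RepClass (CuntzAlgebra n)) (c₂ : RepClass (CuntzAlgebra m)) :
    RepClass (CuntzAlgebra (n * m)) :=
  Quotient.map₂ StarRep.phiTensor (fun _ _ h₁ _ _ h₂ => by
    obtain ⟨U, hU⟩ := StarRep.tensor_congr h₁ h₂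
    exact ⟨U, fun a h => hU (phi n m a) h⟩) c₁ c₂

/-- The product `ω ⊗_φ ω' = (ω ⊗ ω') ∘ φ_{n,m}` of states of Cuntz algebras. -/
def State.phiTensor (ω : State (CuntzAlgebra n)) (ω' : State (CuntzAlgebra m)) :
    State (CuntzAlgebra (n * m)) :=
  (ω.tensor ω').comp (phi n m)

end Cuntz

/-! ### The states `ϱ_z` and the classes `GP(z)` -/

section GP

/-- The Hilbert space `ℓ²(ℕ)`. -/
abbrev Ell2 : Type := lp (fun _ : ℕ => ℂ) 2

/-- The standard basis vectors of `ℓ²(ℕ)`. -/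
def ell2Basis : HilbertBasis ℕ ℂ Ell2 := HilbertBasis.ofRepr (LinearIsometryEquiv.refl ℂ Ell2)

theorem ell2_hom_ext {S T : Ell2 →L[ℂ] Ell2} (h : ∀ k, S (ell2Basis k) = T (ell2Basis k)) :
    S = T := by
  refine ContinuousLinearMap.ext_on (s := Set.range ell2Basis) ?_ ?_
  · exact Submodule.dense_iff_topologicalClosure_eq_top.mpr ell2Basis.dense_span
  · rintro _ ⟨k, rfl⟩
    exact h k

theorem inner_ell2Basis (k l : ℕ) :
    ⟪ell2Basis k, ell2Basis l⟫_ℂ = if k = l then 1 else 0 :=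
  orthonormal_iff_ite.mp ell2Basis.orthonormal k l

theorem ell2_ext_inner {x y : Ell2} (h : ∀ k, ⟪ell2Basis k, x⟫_ℂ = ⟪ell2Basis k, y⟫_ℂ) :
    x = y := by
  apply ell2Basis.repr.injective
  ext k
  rw [ell2Basis.repr_apply_apply, ell2Basis.repr_apply_apply, h]

theorem exists_isometry_of_injective (f : ℕ → ℕ) (hf : Function.Injective f) :
    ∃ T : Ell2 →L[ℂ] Ell2, ∀ k, T (ell2Basis k) = ell2Basis (f k) := by
  have hv : Orthonormal ℂ (fun k => ell2Basis (f k)) := ell2Basis.orthonormal.comp f hf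
  refine ⟨hv.orthogonalFamily.linearIsometry.toContinuousLinearMap ∘L
    (ell2Basis.repr : Ell2 →L[ℂ] Ell2), fun k => ?_⟩
  have h := hv.orthogonalFamily.linearIsometry_apply_single (i := k) (1 : ℂ)
  rw [LinearIsometry.toSpanSingleton_apply, one_smul] at h
  refine Eq.trans ?_ h
  change hv.orthogonalFamily.linearIsometry (ell2Basis.repr (ell2Basis k)) = _
  rw [ell2Basis.repr_self]

/-- The representation of the Cuntz relations on `ℓ²(ℕ)` by `Tᵢ e_k = e_{nk+i}`. -/
theorem exists_cuntzFamily_ell2 (n : ℕ) (hn : 0 < n) :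
    ∃ T : Fin n → (Ell2 →L[ℂ] Ell2), IsCuntzFamily T ∧
      ∀ i, star (T i) (ell2Basis 0) = if i.1 = 0 then ell2Basis 0 else 0 := by
  have hinj : ∀ i : Fin n, Function.Injective (fun k => n * k + i.1) := fun i k l h => by
    have h' : n * k = n * l := by simpa using h
    exact Nat.eq_of_mul_eq_mul_left hn h'
  choose T hT using fun i : Fin n => exists_isometry_of_injective _ (hinj i)
  have hst : ∀ i j k, star (T i) (T j (ell2Basis k)) = if i = j then ell2Basis k else 0 := by
    intro i j k
    refine ell2_ext_inner fun l => ?_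
    rw [ContinuousLinearMap.star_eq_adjoint, ContinuousLinearMap.adjoint_inner_right, hT, hT,
      inner_ell2Basis]
    have hdiv : (n * l + i.1 = n * k + j.1) ↔ (i = j ∧ l = k) := by
      constructor
      · intro h
        have h1 := congrArg (· % n) h
        simp only [Nat.mul_add_mod, Nat.mod_eq_of_lt i.2, Nat.mod_eq_of_lt j.2] at h1
        rw [h1] at h
        exact ⟨Fin.ext h1, hinj j h⟩
      · rintro ⟨rfl, rfl⟩
        rfl
    by_cases hij : i = j
    · subst hij
      simp only [hdiv, true_and, if_true, inner_ell2Basis]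
    · simp [hdiv, hij]
  have hdecomp : ∀ q : ℕ, ∃ (i : Fin n) (k : ℕ), ell2Basis q = T i (ell2Basis k) := fun q =>
    ⟨⟨q % n, Nat.mod_lt q hn⟩, q / n, by rw [hT]; congr 1; exact (Nat.div_add_mod q n).symm⟩
  refine ⟨T, ⟨fun i j => ell2_hom_ext fun k => ?_, ell2_hom_ext fun q => ?_, fun h i => ?_⟩,
    fun i => ?_⟩
  · rw [mul_apply_eq_comp, hst]
    split_ifs <;> simp
  · obtain ⟨i, k, h⟩ := hdecomp q
    rw [h, sum_apply]
    simp only [mul_apply_eq_comp, hst]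
    rw [Finset.sum_eq_single i (fun j _ hj => by rw [if_neg hj, map_zero]) (by simp), if_pos rfl]
    simp
  · subst h
    refine ell2_hom_ext fun k => ?_
    rw [hT]
    simp
  · have h0 : ell2Basis 0 = T ⟨0, hn⟩ (ell2Basis 0) := by rw [hT]; simp
    conv_lhs => rw [h0, hst]
    simp only [Fin.ext_iff]

/-- The parameters of the states `ϱ_z`: the unit vectors of `ℂⁿ`, where for `n = 1` only `z = 1`
is admitted. -/
structure IsGPVector {n : ℕ} (z : EuclideanSpace ℂ (Fin n)) : Prop where
  norm_eq_one : ‖z‖ = 1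
  eq_one : n = 1 → ∀ i, z i = 1

variable {n m : ℕ}

theorem exists_cuntzFamily_eigenvector {z : EuclideanSpace ℂ (Fin n)} (hz : IsGPVector z) :
    ∃ S : Fin n → (Ell2 →L[ℂ] Ell2), IsCuntzFamily S ∧
      ∀ i, star (S i) (ell2Basis 0) = z i • ell2Basis 0 := by
  have hn : 0 < n := by
    rcases Nat.eq_zero_or_pos n with rfl | h
    · have h := hz.norm_eq_one
      rw [Subsingleton.elim z 0, norm_zero] at h
      exact absurd h zero_ne_one
    · exact h
  obtain ⟨T, hT, hT0⟩ := exists_cuntzFamily_ell2 n hn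
  let w : EuclideanSpace ℂ (Fin n) := WithLp.toLp 2 fun i => star (z i)
  have hw : ‖w‖ = 1 := by
    rw [← hz.norm_eq_one, EuclideanSpace.norm_eq, EuclideanSpace.norm_eq]
    simp [w]
  obtain ⟨b, hb⟩ := Orthonormal.exists_orthonormalBasis_extension_of_card_eq (𝕜 := ℂ)
    (E := EuclideanSpace ℂ (Fin n)) (ι := Fin n) (by simp) (v := fun _ => w)
    (s := {⟨0, hn⟩}) (by
      rw [orthonormal_iff_ite]
      rintro ⟨i, rfl⟩ ⟨j, rfl⟩
      simp [Set.domRestrict, inner_self_eq_norm_sq_to_K, hw])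
  have hb0 : b ⟨0, hn⟩ = w := hb _ rfl
  let U : Matrix (Fin n) (Fin n) ℂ := Matrix.of fun i j => b j i
  have hU : star U * U = 1 := by
    ext j l
    have h := orthonormal_iff_ite.mp b.orthonormal j l
    rw [Matrix.mul_apply, Matrix.one_apply, ← h, PiLp.inner_apply]
    refine Finset.sum_congr rfl fun i _ => ?_
    simp [U, Matrix.star_apply, mul_comm]
  have hU' : U * star U = 1 := mul_eq_one_comm.mp hU
  have hstar : ∀ i, star (∑ j, U i j • T j) = ∑ j, star (U i j) • star (T j) := fun i => by
    rw [star_sum]; simp only [star_smul]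
  refine ⟨fun i => ∑ j, U i j • T j, ⟨fun i k => ?_, ?_, fun h i => ?_⟩, fun i => ?_⟩
  · simp only [hstar, Finset.sum_mul_sum, smul_mul_smul_comm, hT.star_mul, smul_ite, smul_zero,
      Finset.sum_ite_eq, Finset.mem_univ, if_true]
    rw [← Finset.sum_smul]
    have h := congrFun (congrFun hU' k) i
    rw [Matrix.mul_apply, Matrix.one_apply] at h
    simp only [Matrix.star_apply] at h
    rw [Finset.sum_congr rfl fun j _ => mul_comm (star (U i j)) (U k j), h]
    simp only [eq_comm (a := k), ite_smul, one_smul, zero_smul]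
  · simp only [hstar, Finset.sum_mul_sum, smul_mul_smul_comm]
    rw [Finset.sum_comm]
    have h : ∀ j l, ∑ i, U i j * star (U i l) = if l = j then 1 else 0 := fun j l => by
      have h := congrFun (congrFun hU l) j
      rw [Matrix.mul_apply, Matrix.one_apply] at h
      rw [← h]
      exact Finset.sum_congr rfl fun i _ => mul_comm _ _
    rw [← hT.sum_mul_star]
    refine Finset.sum_congr rfl fun j _ => ?_
    rw [Finset.sum_comm]
    simp only [← Finset.sum_smul, h, ite_smul, one_smul, zero_smul, Finset.sum_ite_eq',
      Finset.mem_univ, if_true]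
  · subst h
    have hi : i = 0 := Subsingleton.elim _ _
    subst hi
    have h0 : U 0 0 = 1 := by
      change b 0 0 = 1
      rw [show (0 : Fin 1) = ⟨0, hn⟩ from rfl, hb0]
      simp [w, hz.eq_one rfl]
    simp [h0, hT.eq_one rfl]
  · rw [hstar, sum_apply]
    simp only [smul_apply, hT0]
    rw [Finset.sum_eq_single ⟨0, hn⟩ (fun j _ hj => ?_) (by simp), if_pos rfl]
    · congr 1
      change star (b ⟨0, hn⟩ i) = z i
      rw [hb0]
      simp [w]
    · rw [if_neg (fun h => hj (Fin.ext h)), smul_zero]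

/-- The product `s_J = s_{j₁} ⋯ s_{j_a}` of generators. -/
def cuntzWord (J : List (Fin n)) : CuntzAlgebra n := (J.map cuntzGen).prod

/-- For an admissible unit vector `z` there is a state `ϱ_z` of `O_n` with
`ϱ_z(s_{j₁} ⋯ s_{j_a} s_{k_b}⋆ ⋯ s_{k₁}⋆) = z̄_{j₁} ⋯ z̄_{j_a} z_{k_b} ⋯ z_{k₁}`. -/
theorem exists_gpState (z : EuclideanSpace ℂ (Fin n)) (hz : IsGPVector z) :
    ∃ ω : State (CuntzAlgebra n), ∀ J K : List (Fin n),
      ω (cuntzWord J * star (cuntzWord K)) =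
        (J.map fun j => star (z j)).prod * (K.map fun k => z k).prod := by
  obtain ⟨S, hS, hS0⟩ := exists_cuntzFamily_eigenvector hz
  let π : StarRep (CuntzAlgebra n) := { H := Ell2, π := cuntzLift S hS }
  have hw : ∀ K : List (Fin n), star (cuntzLift S hS (cuntzWord K)) (ell2Basis 0) =
      (K.map fun k => z k).prod • ell2Basis 0 := by
    intro K
    induction K with
    | nil => simp [cuntzWord]
    | cons k K ih =>
      rw [cuntzWord, List.map_cons, List.prod_cons, map_mul, star_mul, mul_apply_eq_comp,
        cuntzLift_cuntzGen, hS0, map_smul, ← cuntzWord, ih, List.map_cons, List.prod_cons,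
        smul_smul]
  refine ⟨vectorState π (ell2Basis 0) (ell2Basis.orthonormal.1 0), fun J K => ?_⟩
  rw [vectorState_apply]
  change ⟪ell2Basis 0, cuntzLift S hS (cuntzWord J * star (cuntzWord K)) (ell2Basis 0)⟫_ℂ = _
  rw [map_mul, map_star, mul_apply_eq_comp, hw]
  rw [← ContinuousLinearMap.adjoint_inner_left, ← ContinuousLinearMap.star_eq_adjoint, hw,
    inner_smul_left, inner_smul_right, inner_ell2Basis, if_pos rfl, mul_one]
  congr 1
  induction J with
  | nil => simp
  | cons j J ih => simp_all

/-- The state `ϱ_z` of `O_n`. -/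
def gpState (z : EuclideanSpace ℂ (Fin n)) (hz : IsGPVector z) : State (CuntzAlgebra n) :=
  (exists_gpState z hz).choose

theorem gpState_apply (z : EuclideanSpace ℂ (Fin n)) (hz : IsGPVector z) (J K : List (Fin n)) :
    gpState z hz (cuntzWord J * star (cuntzWord K)) =
      (J.map fun j => star (z j)).prod * (K.map fun k => z k).prod :=
  (exists_gpState z hz).choose_spec J K

/-- The class `GP(z)`: the unitary equivalence class of the GNS representation of `ϱ_z`. -/
def GP (z : EuclideanSpace ℂ (Fin n)) (hz : IsGPVector z) : RepClass (CuntzAlgebra n) :=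
  (gpState z hz).gns.toClass

/-- The vector `z ⊠ y` of `ℂ^{nm}`, with (indices starting at `1`)
`(z ⊠ y)_{m (i - 1) + j} = zᵢ yⱼ`. -/
def boxTimes (z : EuclideanSpace ℂ (Fin n)) (y : EuclideanSpace ℂ (Fin m)) :
    EuclideanSpace ℂ (Fin (n * m)) :=
  WithLp.toLp 2 fun k => z (finProdFinEquiv.symm k).1 * y (finProdFinEquiv.symm k).2

theorem IsGPVector.boxTimes {z : EuclideanSpace ℂ (Fin n)} {y : EuclideanSpace ℂ (Fin m)}
    (hz : IsGPVector z) (hy : IsGPVector y) : IsGPVector (boxTimes z y) where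
  norm_eq_one := by
    have h1 := hz.norm_eq_one
    have h2 := hy.norm_eq_one
    rw [EuclideanSpace.norm_eq, Real.sqrt_eq_one] at h1 h2 ⊢
    rw [← finProdFinEquiv.sum_comp, Fintype.sum_prod_type]
    simp only [CuntzGP.boxTimes, Equiv.symm_apply_apply, norm_mul, mul_pow]
    simp only [← Finset.mul_sum, h2, mul_one, h1]
  eq_one h k := by
    obtain ⟨hn, hm⟩ := mul_eq_one.mp h
    simp [CuntzGP.boxTimes, hz.eq_one hn, hy.eq_one hm]

end GP

end CuntzGP
end

noncomputable section

namespace CuntzGP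

open scoped TensorProduct InnerProductSpace ComplexOrder
open UniformSpace

section CyclicVectors

variable {A : Type} [CStarAlgebra A]

/-- The orbit map `a ↦ π(a) Ω` of a vector `Ω`. -/
def StarRep.orbit (π : StarRep A) (Ω : π.H) : A →ₗ[ℂ] π.H where
  toFun a := π.π a Ω
  map_add' a b := by simp
  map_smul' c a := by simp

theorem StarRep.orbit_apply (π : StarRep A) (Ω : π.H) (a : A) : π.orbit Ω a = π.π a Ω := rfl

theorem StarRep.continuous_orbit (π : StarRep A) (Ω : π.H) : Continuous (π.orbit Ω) :=
  π.continuous_π.clm_apply continuous_const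

theorem StarRep.inner_orbit (π : StarRep A) (Ω : π.H) (a b : A) :
    ⟪π.π a Ω, π.π b Ω⟫_ℂ = ⟪Ω, π.π (star a * b) Ω⟫_ℂ := by
  rw [map_mul, map_star, mul_apply_eq_comp, ContinuousLinearMap.star_eq_adjoint,
    ContinuousLinearMap.adjoint_inner_right]

/-- Two cyclic representations with the same vector functional are unitarily equivalent. -/
theorem StarRep.unitaryEquiv_of_inner_eq {π₁ π₂ : StarRep A} {Ω₁ : π₁.H} {Ω₂ : π₂.H}
    (h₁ : DenseRange (π₁.orbit Ω₁)) (h₂ : DenseRange (π₂.orbit Ω₂))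
    (h : ∀ a, ⟪Ω₁, π₁.π a Ω₁⟫_ℂ = ⟪Ω₂, π₂.π a Ω₂⟫_ℂ) : π₁.UnitaryEquiv π₂ := by
  have hnorm : ∀ a, ‖π₂.orbit Ω₂ (LinearEquiv.refl ℂ A a)‖ = ‖π₁.orbit Ω₁ a‖ := fun a => by
    rw [LinearEquiv.refl_apply, norm_eq_sqrt_re_inner (𝕜 := ℂ), norm_eq_sqrt_re_inner (𝕜 := ℂ)]
    simp only [orbit_apply, inner_orbit, h]
  let U := (LinearEquiv.refl ℂ A).extendOfIsometry _ _ h₁ h₂ hnorm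
  have hU : ∀ a, U (π₁.orbit Ω₁ a) = π₂.orbit Ω₂ a :=
    (LinearEquiv.refl ℂ A).extendOfIsometry_eq _ _ h₁ h₂ hnorm
  refine ⟨U, fun a x => ?_⟩
  refine h₁.induction_on x (isClosed_eq (U.continuous.comp (π₁.π a).continuous)
    ((π₂.π a).continuous.comp U.continuous)) fun b => ?_
  have hmul : π₁.π a (π₁.orbit Ω₁ b) = π₁.orbit Ω₁ (a * b) := by
    rw [orbit_apply, orbit_apply, map_mul, mul_apply_eq_comp]
  rw [hmul, hU, hU, orbit_apply, orbit_apply, map_mul, mul_apply_eq_comp]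

variable [PartialOrder A] [StarOrderedRing A]

theorem State.gns_orbit_gnsVec (ω : State A) (a : A) :
    ω.gns.orbit ω.gnsVec a =
      ((ω.toPos.toPreGNS a : ω.toPos.PreGNS) : Completion ω.toPos.PreGNS) := by
  change ω.toPos.gnsNonUnitalStarAlgHom a _ = _
  rw [State.gnsVec, PositiveLinearMap.gnsNonUnitalStarAlgHom_apply_coe]
  simp

theorem State.denseRange_gns_orbit (ω : State A) : DenseRange (ω.gns.orbit ω.gnsVec) := by
  have h : (ω.gns.orbit ω.gnsVec : A → ω.gns.H) =
      (fun x : ω.toPos.PreGNS => (x : Completion ω.toPos.PreGNS)) ∘ ω.toPos.toPreGNS :=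
    funext ω.gns_orbit_gnsVec
  rw [h]
  exact Completion.denseRange_coe.comp ω.toPos.toPreGNS.surjective.denseRange
    (Completion.continuous_coe _)

theorem State.continuous (ω : State A) : Continuous ω := by
  have h : (ω : A → ℂ) = fun a => ⟪ω.gnsVec, ω.gns.orbit ω.gnsVec a⟫_ℂ :=
    funext fun a => (ω.inner_gnsVec a).symm
  rw [h]
  exact continuous_const.inner (ω.gns.continuous_orbit _)

end CyclicVectors

section CuntzWords

variable {n m : ℕ}

theorem cuntzWord_nil : cuntzWord ([] : List (Fin n)) = 1 := rfl

theorem cuntzWord_cons (i : Fin n) (J : List (Fin n)) :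
    cuntzWord (i :: J) = cuntzGen i * cuntzWord J := by
  simp [cuntzWord]

theorem cuntzWord_append (J K : List (Fin n)) :
    cuntzWord (J ++ K) = cuntzWord J * cuntzWord K := by
  simp [cuntzWord]

theorem toCuntz_mem_span (x : FreeStarAlgebra (Fin n)) :
    toCuntz n x ∈ Submodule.span ℂ
      (Set.range fun p : List (Fin n) × List (Fin n) => cuntzWord p.1 * star (cuntzWord p.2)) := by
  set M := Submodule.span ℂ
    (Set.range fun p : List (Fin n) × List (Fin n) => cuntzWord p.1 * star (cuntzWord p.2))
  have hM : ∀ J K : List (Fin n), cuntzWord J * star (cuntzWord K) ∈ M := fun J K =>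
    Submodule.subset_span ⟨(J, K), rfl⟩
  have hmul : ∀ a : CuntzAlgebra n,
      (∀ J K : List (Fin n), a * (cuntzWord J * star (cuntzWord K)) ∈ M) →
      ∀ x ∈ M, a * x ∈ M := by
    intro a ha x hx
    induction hx using Submodule.span_induction with
    | mem x hx => obtain ⟨p, rfl⟩ := hx; exact ha p.1 p.2
    | zero => rw [mul_zero]; exact M.zero_mem
    | add x y _ _ hx hy => rw [mul_add]; exact M.add_mem hx hy
    | smul c x _ hx => rw [mul_smul_comm]; exact M.smul_mem c hx
  induction x using freeStar_induction' with
  | h0 => rw [map_zero]; exact M.zero_mem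
  | h1 => simpa [cuntzWord_nil] using hM [] []
  | hadd x y hx hy => rw [map_add]; exact M.add_mem hx hy
  | hsmul c x hx => rw [map_smul]; exact M.smul_mem c hx
  | hgen i x hx =>
    rw [map_mul]
    refine hmul _ (fun J K => ?_) _ hx
    have h := hM (i :: J) K
    rwa [cuntzWord_cons, mul_assoc] at h
  | hstar i x hx =>
    rw [map_mul, map_star]
    refine hmul _ (fun J K => ?_) _ hx
    change star (cuntzGen i) * _ ∈ M
    cases J with
    | nil =>
      have h := hM [] (K ++ [i])
      simpa [cuntzWord_append, cuntzWord_cons, cuntzWord_nil] using h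
    | cons j J =>
      rw [cuntzWord_cons, ← mul_assoc, ← mul_assoc, (isCuntzFamily_cuntzGen n).star_mul]
      split_ifs
      · rw [one_mul]; exact hM J K
      · rw [zero_mul, zero_mul]; exact M.zero_mem

/-- The linear span of the elements `s_J s_K⋆` is dense in `O_n`. -/
theorem cuntz_induction {P : CuntzAlgebra n → Prop} (hc : IsClosed {x | P x}) (h0 : P 0)
    (hadd : ∀ x y, P x → P y → P (x + y)) (hsmul : ∀ (c : ℂ) x, P x → P (c • x))
    (hw : ∀ J K, P (cuntzWord J * star (cuntzWord K))) (x) : P x := by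
  refine (denseRange_toCuntz n).induction_on x hc fun y => ?_
  refine Submodule.span_induction (p := fun x _ => P x) ?_ h0 (fun x y _ _ => hadd x y)
    (fun c x _ => hsmul c x) (toCuntz_mem_span y)
  rintro _ ⟨p, rfl⟩
  exact hw p.1 p.2

theorem State.ext_cuntzWord {ω ω' : State (CuntzAlgebra n)}
    (h : ∀ J K, ω (cuntzWord J * star (cuntzWord K)) = ω' (cuntzWord J * star (cuntzWord K))) :
    ω = ω' := by
  have hx : ∀ x, ω x = ω' x := fun x => by
    induction x using cuntz_induction with
    | hc => exact isClosed_eq ω.continuous ω'.continuous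
    | h0 => rw [map_zero, map_zero]
    | hadd x y hx hy => rw [map_add, map_add, hx, hy]
    | hsmul c x hx => rw [map_smul, map_smul, hx]
    | hw J K => exact h J K
  exact State.ext (DFunLike.ext _ _ hx)

theorem phi_cuntzWord (J : List (Fin (n * m))) :
    phi n m (cuntzWord J) =
      minTmul (cuntzWord (J.map fun k => (finProdFinEquiv.symm k).1))
        (cuntzWord (J.map fun k => (finProdFinEquiv.symm k).2)) := by
  induction J with
  | nil => simp only [List.map_nil, cuntzWord_nil, map_one, minTmul_one_one]
  | cons k J ih =>
    rw [cuntzWord_cons, map_mul, ih, phi, cuntzLift_cuntzGen, phiGen, minTmul_mul, List.map_cons,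
      List.map_cons, cuntzWord_cons, cuntzWord_cons]

theorem exists_phi_eq_minTmul (J : List (Fin n)) (K : List (Fin m)) (h : J.length = K.length) :
    ∃ a, phi n m a = minTmul (cuntzWord J) (cuntzWord K) := by
  refine ⟨cuntzWord ((J.zip K).map finProdFinEquiv), ?_⟩
  rw [phi_cuntzWord, List.map_map, List.map_map]
  simp only [Function.comp_def, Equiv.symm_apply_apply]
  congr 2
  · exact List.map_fst_zip h.le
  · exact List.map_snd_zip h.ge

end CuntzWords

section CuntzEigenvectors

variable {n m : ℕ}

/-- `Ω` is a joint eigenvector of the adjoints of the generators: `π(sᵢ)⋆ Ω = zᵢ Ω`. -/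
def StarRep.IsCuntzEigenvector (π : StarRep (CuntzAlgebra n)) (z : Fin n → ℂ) (Ω : π.H) : Prop :=
  ∀ i, π.π (star (cuntzGen i)) Ω = z i • Ω

theorem gnsVec_isCuntzEigenvector {z : EuclideanSpace ℂ (Fin n)} (hz : IsGPVector z) :
    (gpState z hz).gns.IsCuntzEigenvector z (gpState z hz).gnsVec := by
  intro i
  set ω := gpState z hz
  set v := ω.gns.π (star (cuntzGen i)) ω.gnsVec with hv
  have h1 : ⟪ω.gnsVec, v⟫_ℂ = z i := by
    rw [hv, ω.inner_gnsVec]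
    simpa [cuntzWord] using gpState_apply z hz [] [i]
  have h2 : ⟪v, v⟫_ℂ = star (z i) * z i := by
    rw [hv, StarRep.inner_orbit, ω.inner_gnsVec, star_star]
    simpa [cuntzWord] using gpState_apply z hz [i] [i]
  have h3 : ⟪v, ω.gnsVec⟫_ℂ = star (z i) := by
    rw [← inner_conj_symm, h1]; rfl
  have h4 : ⟪ω.gnsVec, ω.gnsVec⟫_ℂ = 1 := by
    rw [inner_self_eq_norm_sq_to_K, ω.norm_gnsVec]; simp
  rw [← sub_eq_zero, ← inner_self_eq_zero (𝕜 := ℂ)]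
  rw [inner_sub_left, inner_sub_right, inner_sub_right, inner_smul_left, inner_smul_left,
    inner_smul_right, inner_smul_right, h1, h2, h3, h4, starRingEnd_apply]
  ring

namespace StarRep.IsCuntzEigenvector

variable {π : StarRep (CuntzAlgebra n)} {z : Fin n → ℂ} {Ω : π.H}

theorem star_cuntzWord (h : π.IsCuntzEigenvector z Ω) (K : List (Fin n)) :
    ∃ c : ℂ, π.π (star (cuntzWord K)) Ω = c • Ω := by
  induction K with
  | nil => exact ⟨1, by simp [cuntzWord_nil]⟩
  | cons k K ih =>
    obtain ⟨c, hc⟩ := ih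
    exact ⟨z k * c, by
      rw [cuntzWord_cons, star_mul, map_mul, mul_apply_eq_comp, h k, map_smul, hc, smul_smul]⟩

theorem sum_smul (h : π.IsCuntzEigenvector z Ω) (J : List (Fin n)) :
    π.π (cuntzWord J) Ω = ∑ i, z i • π.π (cuntzWord (J ++ [i])) Ω := by
  have h1 : cuntzWord J = ∑ i, cuntzWord (J ++ [i]) * star (cuntzGen i) := by
    simp only [cuntzWord_append, cuntzWord_cons, cuntzWord_nil, mul_one, mul_assoc]
    rw [← Finset.mul_sum, (isCuntzFamily_cuntzGen n).sum_mul_star, mul_one]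
  conv_lhs => rw [h1, map_sum, sum_apply]
  exact Finset.sum_congr rfl fun i _ => by rw [map_mul, mul_apply_eq_comp, h i, map_smul]

/-- If `Ω` is cyclic, then the vectors `π(s_J) Ω` span a dense subspace. -/
theorem induction_on (h : π.IsCuntzEigenvector z Ω) (hΩ : DenseRange (π.orbit Ω))
    {P : π.H → Prop} (hc : IsClosed {x | P x}) (h0 : P 0)
    (hadd : ∀ x y, P x → P y → P (x + y)) (hsmul : ∀ (c : ℂ) x, P x → P (c • x))
    (hw : ∀ J, P (π.π (cuntzWord J) Ω)) (x : π.H) : P x := by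
  refine hΩ.induction_on x hc fun a => ?_
  induction a using cuntz_induction with
  | hc => exact hc.preimage (π.continuous_orbit Ω)
  | h0 => rw [map_zero]; exact h0
  | hadd a b ha hb => rw [map_add]; exact hadd _ _ ha hb
  | hsmul c a ha => rw [map_smul]; exact hsmul c _ ha
  | hw J K =>
    obtain ⟨c, hc⟩ := h.star_cuntzWord K
    rw [orbit_apply, map_mul, mul_apply_eq_comp, hc, map_smul]
    exact hsmul c _ (hw J)

end StarRep.IsCuntzEigenvector

theorem continuous_hTmul {H₁ H₂ : Type} [NormedAddCommGroup H₁] [InnerProductSpace ℂ H₁]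
    [NormedAddCommGroup H₂] [InnerProductSpace ℂ H₂] :
    (∀ a : H₁, Continuous fun b : H₂ => hTmul a b) ∧
      ∀ b : H₂, Continuous fun a : H₁ => hTmul a b := by
  refine ⟨fun a => ?_, fun b => ?_⟩
  · let f : H₂ →ₗ[ℂ] HilbertTensor H₁ H₂ :=
      { toFun := fun b => hTmul a b
        map_add' := hTmul_add_right a
        map_smul' := fun c b => hTmul_smul_right c a b }
    exact (f.mkContinuous ‖a‖ fun b => (norm_hTmul a b).le).continuous
  · let f : H₁ →ₗ[ℂ] HilbertTensor H₁ H₂ :=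
      { toFun := fun a => hTmul a b
        map_add' := fun a a' => hTmul_add_left a a' b
        map_smul' := fun c a => hTmul_smul_left c a b }
    exact (f.mkContinuous ‖b‖ fun a => (norm_hTmul a b).le.trans (mul_comm _ _).le).continuous

variable {π₁ : StarRep (CuntzAlgebra n)} {π₂ : StarRep (CuntzAlgebra m)} {z : Fin n → ℂ}
  {y : Fin m → ℂ} {Ω₁ : π₁.H} {Ω₂ : π₂.H}

theorem hTmul_cuntzWord_mem_range (h₁ : π₁.IsCuntzEigenvector z Ω₁)
    (h₂ : π₂.IsCuntzEigenvector y Ω₂) (J : List (Fin n)) (K : List (Fin m)) :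
    (hTmul (π₁.π (cuntzWord J) Ω₁) (π₂.π (cuntzWord K) Ω₂) : (π₁.phiTensor π₂).H) ∈
      LinearMap.range ((π₁.phiTensor π₂).orbit (π₁.tensorVec π₂ Ω₁ Ω₂)) := by
  set M : Submodule ℂ (HilbertTensor π₁.H π₂.H) :=
    LinearMap.range ((π₁.phiTensor π₂).orbit (π₁.tensorVec π₂ Ω₁ Ω₂))
  change hTmul (π₁.π (cuntzWord J) Ω₁) (π₂.π (cuntzWord K) Ω₂) ∈ M
  have hsumL : ∀ (c : Fin n → ℂ) (x : Fin n → π₁.H) (w : π₂.H),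
      (∀ i, hTmul (x i) w ∈ M) → hTmul (∑ i, c i • x i) w ∈ M := by
    intro c x w hx
    rw [hTmul, TensorProduct.sum_tmul, map_sum]
    exact M.sum_mem fun i _ => by
      have h := M.smul_mem (c i) (hx i)
      rwa [← hTmul_smul_left] at h
  have hsumR : ∀ (c : Fin m → ℂ) (x : Fin m → π₂.H) (w : π₁.H),
      (∀ i, hTmul w (x i) ∈ M) → hTmul w (∑ i, c i • x i) ∈ M := by
    intro c x w hx
    rw [hTmul, TensorProduct.tmul_sum, map_sum]
    exact M.sum_mem fun i _ => by
      have h := M.smul_mem (c i) (hx i)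
      rwa [← hTmul_smul_right] at h
  rcases le_total J.length K.length with h | h
  · obtain ⟨d, hd⟩ := Nat.exists_eq_add_of_le h
    clear h
    induction d generalizing J with
    | zero =>
      obtain ⟨a, ha⟩ := exists_phi_eq_minTmul J K hd.symm
      refine ⟨a, ?_⟩
      change (π₁.tensor π₂).π (phi n m a) (π₁.tensorVec π₂ Ω₁ Ω₂) = _
      rw [ha, StarRep.tensor_π_tensorVec]
      rfl
    | succ d ih =>
      rw [h₁.sum_smul J]
      exact hsumL _ _ _ fun i => ih (J ++ [i]) (by rw [hd, List.length_append]; simp; omega)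
  · obtain ⟨d, hd⟩ := Nat.exists_eq_add_of_le h
    clear h
    induction d generalizing K with
    | zero =>
      obtain ⟨a, ha⟩ := exists_phi_eq_minTmul J K hd
      refine ⟨a, ?_⟩
      change (π₁.tensor π₂).π (phi n m a) (π₁.tensorVec π₂ Ω₁ Ω₂) = _
      rw [ha, StarRep.tensor_π_tensorVec]
      rfl
    | succ d ih =>
      rw [h₂.sum_smul K]
      exact hsumR _ _ _ fun i => ih (K ++ [i]) (by rw [hd, List.length_append]; simp; omega)

/-- The tensor product of two cyclic eigenvectors is cyclic for `π₁ ⊗_φ π₂`. -/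
theorem denseRange_phiTensor_orbit (h₁ : π₁.IsCuntzEigenvector z Ω₁)
    (h₂ : π₂.IsCuntzEigenvector y Ω₂) (hΩ₁ : DenseRange (π₁.orbit Ω₁))
    (hΩ₂ : DenseRange (π₂.orbit Ω₂)) :
    DenseRange ((π₁.phiTensor π₂).orbit (π₁.tensorVec π₂ Ω₁ Ω₂)) := by
  let R : Submodule ℂ (HilbertTensor π₁.H π₂.H) :=
    LinearMap.range ((π₁.phiTensor π₂).orbit (π₁.tensorVec π₂ Ω₁ Ω₂))
  let M : Submodule ℂ (HilbertTensor π₁.H π₂.H) := R.topologicalClosure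
  have hMc : IsClosed (M : Set (HilbertTensor π₁.H π₂.H)) := Submodule.isClosed_topologicalClosure _
  have key : ∀ (a : π₁.H) (b : π₂.H), hTmul a b ∈ M := by
    intro a b
    induction a using h₁.induction_on hΩ₁ with
    | hc => exact hMc.preimage (continuous_hTmul.2 b)
    | h0 => simp [hTmul]
    | hadd x x' hx hx' => rw [hTmul_add_left]; exact M.add_mem hx hx'
    | hsmul c x hx => rw [hTmul_smul_left]; exact M.smul_mem c hx
    | hw J =>
      induction b using h₂.induction_on hΩ₂ with
      | hc => exact hMc.preimage (continuous_hTmul.1 _)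
      | h0 => simp [hTmul]
      | hadd x x' hx hx' => rw [hTmul_add_right]; exact M.add_mem hx hx'
      | hsmul c x hx => rw [hTmul_smul_right]; exact M.smul_mem c hx
      | hw K => exact R.le_topologicalClosure (hTmul_cuntzWord_mem_range h₁ h₂ J K)
  intro x
  change x ∈ M
  exact hilbertTensor_induction (P := fun x => x ∈ M) hMc M.zero_mem key
    (fun x y hx hy => M.add_mem hx hy) x

end CuntzEigenvectors

section GPStates

variable {n m : ℕ} {z : EuclideanSpace ℂ (Fin n)} {y : EuclideanSpace ℂ (Fin m)}

theorem gpState_phiTensor (hz : IsGPVector z) (hy : IsGPVector y) :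
    (gpState z hz).phiTensor (gpState y hy) = gpState (boxTimes z y) (hz.boxTimes hy) := by
  refine State.ext_cuntzWord fun J K => ?_
  rw [State.phiTensor, State.comp_apply, map_mul, map_star, phi_cuntzWord, phi_cuntzWord,
    star_minTmul, minTmul_mul, State.tensor_minTmul, gpState_apply, gpState_apply, gpState_apply]
  simp only [List.map_map, Function.comp_def, boxTimes, star_mul', List.prod_map_mul]
  ring

theorem GP_phiTensor (hz : IsGPVector z) (hy : IsGPVector y) :
    (GP z hz).phiTensor (GP y hy) = GP (boxTimes z y) (hz.boxTimes hy) := by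
  refine Quotient.sound ?_
  refine StarRep.unitaryEquiv_of_inner_eq
    (denseRange_phiTensor_orbit (gnsVec_isCuntzEigenvector hz) (gnsVec_isCuntzEigenvector hy)
      (State.denseRange_gns_orbit _) (State.denseRange_gns_orbit _))
    (State.denseRange_gns_orbit _) fun a => ?_
  rw [State.inner_gnsVec, ← gpState_phiTensor hz hy]
  rfl

end GPStates

end CuntzGP
end

theorem theorem3p2 (n m : ℕ) (z : EuclideanSpace ℂ (Fin n)) (y : EuclideanSpace ℂ (Fin m))
    (hz : CuntzGP.IsGPVector z) (hy : CuntzGP.IsGPVector y) :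
    (CuntzGP.gpState z hz).phiTensor (CuntzGP.gpState y hy) =
        CuntzGP.gpState (CuntzGP.boxTimes z y) (hz.boxTimes hy) ∧
      (CuntzGP.GP z hz).phiTensor (CuntzGP.GP y hy) =
        CuntzGP.GP (CuntzGP.boxTimes z y) (hz.boxTimes hy) :=
  ⟨CuntzGP.gpState_phiTensor hz hy, CuntzGP.GP_phiTensor hz hy⟩
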